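/- Let $\mathscr L$ be a real Hilbert space, $(\Omega,\mathcal F,\mathbb P)$ a probability space and $\Phi:\mathscr L\to L^2(\Omega,\mathbb P)$ (real-valued functions) a Gaussian field, i.e. a linear map such that $(\Phi(h))_{h\in\mathscr L}$ is a centered Gaussian process with $\mathbb E(\Phi(h)\Phi(k))=\langle h,k\rangle$. Assume that $\mathcal F$ is generated by $\Phi$ up to $\mathbb P$-null sets. Let $\Gamma_{sym}(\mathscr L)=\bigoplus_{n\ge0}\mathscr L^{\otimes_s n}$ be the symmetric Fock space (Hilbert direct sum of the symmetric subspaces of the Hilbert tensor powers), $\mathscr D_F\subset\Gamma_{sym}(\mathscr L)$ the finite sums of algebraic symmetric tensors, and $e^k=\sum_{n\ge0}k^{\otimes n}/\sqrt{n!}$. Let $CCR(\mathscr L)$ be the unital real $*$-algebra generated by $a(h)$ and $a^*(h)=a(h)^*$, linear in $h\in\mathscr L$, with $[a(h),a(k)]=[a^*(h),a^*(k)]=0$ and $[a(h),a^*(k)]=\langle h,k\rangle 1$, and let $\pi_F:CCR(\mathscr L)\to End(\mathscr D_F)$ be the Fock representation: for a symmetric $n$-tensor $x$, $\pi_F(a^*(k))x=\sqrt{n+1}\,\mathrm{Sym}(k\otimes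 x)$ and $\pi_F(a(k))x=\sqrt n\,(\langle k,\cdot\rangle\otimes 1\otimes\cdots\otimes 1)x$ (which is $0$ if $n=0$). Then there is exactly one state $\omega_{Fock}$ on $CCR(\mathscr L)$ (a normalized positive linear functional with $\omega(A^*)=\omega(A)$) satisfying $\omega(a(h)a^*(k))=\langle h,k\rangle$ and $\omega(a^*(h)a(h))=0$ for all $h,k$. It is the vector state of the vacuum under $\pi_F$, and $\pi_F$ is its representation: $\pi_F$ is a $*$-representation, the vacuum is algebraically cyclic for $\mathscr D_F$, and $\mathscr D_F$ is dense. Let $\mathscr D\subset L^2(\Omega,\mathbb P)$ be the space of polynomial fields $p(\Phi(h_1),\dots,\Phi(h_n))$, $p\in\mathbb R[x_1,\dots,x_n]$. Then $\mathscr D$ is dense, and the Malliavin derivative $$T\,p(\Phi(h_1),\dots,\Phi(h_n))=\sum_{j=1}^n\frac{\partial p}{\partial x_j}(\Phi(h_1),\dots,\Phi(h_n))\otimes h_j\in L^2(\Omega,\mathbb P)\otimes\mathscr L=L^2(\Omega\to\mathscr L,\mathbb P)$$ is a well-defined linear operator with domain $\mathscr D$. Put $T_kF=\langle T(F),k\rangle$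 and let $M_{\Phi(k)}$ be multiplication by $\Phi(k)$, with its natural domain. There is a unique unitary (surjective linear isometry) $W:\Gamma_{sym}(\mathscr L)\to L^2(\Omega,\mathbb P)$ with $$W(e^k)=e^{\Phi(k)-\frac12\|k\|^2}\qquad(k\in\mathscr L),$$ and for all $k\in\mathscr L$ $$T_k=W\,\pi_F(a(k))\,W^*,\qquad M_{\Phi(k)}-T_k=W\,\pi_F(a^*(k))\,W^*$$ as operators with domain $\mathscr D$; in particular $W\mathscr D_F=\mathscr D\subset dom(M_{\Phi(k)})$, and both identities hold on $\mathscr D$. -/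

import Mathlib

open MeasureTheory ProbabilityTheory
open scoped RealInnerProductSpace TensorProduct DirectSum

noncomputable section

namespace BoseFock

section Tensor

variable (L : Type*) [NormedAddCommGroup L] [InnerProductSpace ℝ L]

/-- The algebraic `n`-fold tensor power of `L` as a vector space: a copy of Mathlib's, without
the projective seminorm. -/
def RawTensor (n : ℕ) : Type _ := ⨂[ℝ] _ : Fin n, L

instance (n : ℕ) : AddCommGroup (RawTensor L n) :=
  inferInstanceAs (AddCommGroup (⨂[ℝ] _ : Fin n, L))

instance (n : ℕ) : Module ℝ (RawTensor L n) :=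
  inferInstanceAs (Module ℝ (⨂[ℝ] _ : Fin n, L))

/-- The elementary tensors `h₁ ⊗ ⋯ ⊗ hₙ`. -/
def rawElem (n : ℕ) : MultilinearMap ℝ (fun _ : Fin n => L) (RawTensor L n) :=
  PiTensorProduct.tprod ℝ

/-- The bilinear form with `(h₁ ⊗ ⋯ ⊗ hₙ, k₁ ⊗ ⋯ ⊗ kₙ) ↦ ∏ᵢ ⟪hᵢ, kᵢ⟫`. -/
def tensorForm (n : ℕ) : RawTensor L n →ₗ[ℝ] RawTensor L n →ₗ[ℝ] ℝ :=
  TensorPower.pairingDual ℝ L n ∘ₗ PiTensorProduct.map (fun _ => innerₗ L)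

variable {L}

theorem tensorForm_elem {n : ℕ} (h k : Fin n → L) :
    tensorForm L n (rawElem L n h) (rawElem L n k) = ∏ i, ⟪h i, k i⟫ := by
  change TensorPower.pairingDual ℝ L n (PiTensorProduct.map _ (PiTensorProduct.tprod ℝ h))
    (PiTensorProduct.tprod ℝ k) = _
  rw [PiTensorProduct.map_tprod, TensorPower.pairingDual_tprod_tprod]
  rfl

/-- Linear maps out of a tensor power agree if they agree on elementary tensors. -/
theorem RawTensor.hom_ext {n : ℕ} {E : Type*} [AddCommGroup E] [Module ℝ E]
    {f g : RawTensor L n →ₗ[ℝ] E}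
    (H : ∀ h, f (rawElem L n h) = g (rawElem L n h)) : f = g :=
  PiTensorProduct.ext (MultilinearMap.ext H)

theorem tensorForm_symm {n : ℕ} (x y : RawTensor L n) : tensorForm L n y x = tensorForm L n x y := by
  have : (tensorForm L n).flip = tensorForm L n := by
    refine RawTensor.hom_ext fun h => RawTensor.hom_ext fun k => ?_
    rw [LinearMap.flip_apply, tensorForm_elem, tensorForm_elem]
    exact Finset.prod_congr rfl fun i _ => real_inner_comm _ _
  exact LinearMap.congr_fun (LinearMap.congr_fun this x) y

/-- Every tensor is a finite combination of elementary tensors over an orthonormal family. -/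
theorem RawTensor.exists_orthonormal_expansion {n : ℕ} (x : RawTensor L n) :
    ∃ (N : ℕ) (b : Fin N → L) (d : (Fin n → Fin N) → ℝ), Orthonormal ℝ b ∧
      x = ∑ p, d p • rawElem L n (fun i => b (p i)) := by
  obtain ⟨E, hE, y, rfl⟩ : ∃ (E : Submodule ℝ L), FiniteDimensional ℝ E ∧
      ∃ y : ⨂[ℝ] _ : Fin n, E, PiTensorProduct.map (fun _ => E.subtype) y = x := by
    have hmono : ∀ (E E' : Submodule ℝ L), E ≤ E' → ∀ y : ⨂[ℝ] _ : Fin n, E,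
        ∃ y' : ⨂[ℝ] _ : Fin n, E', PiTensorProduct.map (fun _ => E'.subtype) y' =
          PiTensorProduct.map (fun _ => E.subtype) y := fun E E' hle y =>
      ⟨PiTensorProduct.map (fun _ => Submodule.inclusion hle) y, by
        rw [← LinearMap.comp_apply, ← PiTensorProduct.map_comp]; rfl⟩
    induction x using PiTensorProduct.induction_on with
    | smul_tprod r f =>
      refine ⟨Submodule.span ℝ (Set.range f), FiniteDimensional.span_of_finite ℝ
        (Set.finite_range f), r • PiTensorProduct.tprod ℝ
          (fun i => ⟨f i, Submodule.subset_span ⟨i, rfl⟩⟩), ?_⟩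
      rw [map_smul, PiTensorProduct.map_tprod]; rfl
    | add x y hx hy =>
      obtain ⟨E, hE, u, rfl⟩ := hx
      obtain ⟨E', hE', v, rfl⟩ := hy
      obtain ⟨u', hu⟩ := hmono E (E ⊔ E') le_sup_left u
      obtain ⟨v', hv⟩ := hmono E' (E ⊔ E') le_sup_right v
      exact ⟨E ⊔ E', inferInstance, u' + v', by rw [map_add, hu, hv]⟩
  let b := stdOrthonormalBasis ℝ E
  let B := Basis.piTensorProduct (fun _ : Fin n => b.toBasis)
  refine ⟨_, fun i => (b i : L), B.repr y, b.orthonormal.comp_linearIsometry E.subtypeₗᵢ, ?_⟩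
  conv_lhs => rw [← B.sum_repr y]
  rw [map_sum]
  refine Finset.sum_congr rfl fun p _ => ?_
  rw [map_smul, Basis.piTensorProduct_apply, PiTensorProduct.map_tprod]
  simp only [OrthonormalBasis.coe_toBasis]
  rfl

theorem tensorForm_self {n N : ℕ} {b : Fin N → L} (hb : Orthonormal ℝ b)
    (d : (Fin n → Fin N) → ℝ) :
    tensorForm L n (∑ p, d p • rawElem L n (fun i => b (p i)))
      (∑ p, d p • rawElem L n (fun i => b (p i))) = ∑ p, d p ^ 2 := by
  simp only [map_sum, map_smul, LinearMap.sum_apply, LinearMap.smul_apply, tensorForm_elem,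
    smul_eq_mul]
  refine Finset.sum_congr rfl fun p _ => ?_
  rw [Finset.sum_eq_single p]
  · rw [Finset.prod_eq_one fun i _ => ?_]
    · ring
    · rw [real_inner_self_eq_norm_sq, hb.1]; norm_num
  · intro q _ hq
    obtain ⟨i, hi⟩ := Function.ne_iff.1 hq
    rw [Finset.prod_eq_zero (Finset.mem_univ i)]
    · ring
    · exact hb.2 (by simpa using hi)
  · simp

/-- The inner product on the tensor power,
`⟪h₁ ⊗ ⋯ ⊗ hₙ, k₁ ⊗ ⋯ ⊗ kₙ⟫ = ∏ᵢ ⟪hᵢ, kᵢ⟫`. -/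
@[reducible]
def tensorCore (n : ℕ) : InnerProductSpace.Core ℝ (RawTensor L n) where
  inner x y := tensorForm L n x y
  conj_inner_symm x y := tensorForm_symm x y
  add_left := by simp
  smul_left := by simp
  re_inner_nonneg x := by
    obtain ⟨N, b, d, hb, rfl⟩ := x.exists_orthonormal_expansion
    rw [tensorForm_self hb]
    exact Finset.sum_nonneg fun _ _ => sq_nonneg _
  definite x hx := by
    obtain ⟨N, b, d, hb, rfl⟩ := x.exists_orthonormal_expansion
    rw [tensorForm_self hb, Finset.sum_eq_zero_iff_of_nonneg fun _ _ => sq_nonneg _] at hx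
    refine Finset.sum_eq_zero fun p hp => ?_
    rw [pow_eq_zero_iff (two_ne_zero)|>.1 (hx p hp), zero_smul]

variable (L) in
/-- The algebraic `n`-fold tensor power of `L` with its inner product. -/
def TensorPow (n : ℕ) : Type _ := RawTensor L n

instance (n : ℕ) : NormedAddCommGroup (TensorPow L n) :=
  (tensorCore (L := L) n).toNormedAddCommGroup

instance (n : ℕ) : InnerProductSpace ℝ (TensorPow L n) :=
  InnerProductSpace.ofCore (tensorCore (L := L) n).toCore

variable (L) in
/-- The elementary tensors `h₁ ⊗ ⋯ ⊗ hₙ`. -/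
def elemTensor (n : ℕ) : MultilinearMap ℝ (fun _ : Fin n => L) (TensorPow L n) :=
  rawElem L n

/-- Linear maps out of a tensor power agree if they agree on elementary tensors. -/
theorem TensorPow.hom_ext {n : ℕ} {E : Type*} [AddCommGroup E] [Module ℝ E]
    {f g : TensorPow L n →ₗ[ℝ] E}
    (H : ∀ h, f (elemTensor L n h) = g (elemTensor L n h)) : f = g :=
  RawTensor.hom_ext (L := L) H

/-- The linear map out of a tensor power induced by a multilinear map. -/
def TensorPow.lift {n : ℕ} {E : Type*} [AddCommGroup E] [Module ℝ E]
    (f : MultilinearMap ℝ (fun _ : Fin n => L) E) : TensorPow L n →ₗ[ℝ] E :=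
  PiTensorProduct.lift f

theorem TensorPow.lift_elem {n : ℕ} {E : Type*} [AddCommGroup E] [Module ℝ E]
    (f : MultilinearMap ℝ (fun _ : Fin n => L) E) (h : Fin n → L) :
    TensorPow.lift f (elemTensor L n h) = f h :=
  PiTensorProduct.lift.tprod h

theorem inner_elem {n : ℕ} (h k : Fin n → L) :
    ⟪elemTensor L n h, elemTensor L n k⟫ = ∏ i, ⟪h i, k i⟫ :=
  tensorForm_elem h k

/-- A tensor is determined by its inner products with elementary tensors. -/
theorem TensorPow.ext_inner {n : ℕ} {x y : TensorPow L n}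
    (H : ∀ h, ⟪x, elemTensor L n h⟫ = ⟪y, elemTensor L n h⟫) : x = y := by
  have : innerₗ (TensorPow L n) x = innerₗ (TensorPow L n) y := TensorPow.hom_ext H
  exact ext_inner_right ℝ fun v => LinearMap.congr_fun this v

/-- Permutation of the tensor factors. -/
def permute {n : ℕ} (σ : Equiv.Perm (Fin n)) : TensorPow L n →ₗ[ℝ] TensorPow L n :=
  (PiTensorProduct.reindex ℝ (fun _ : Fin n => L) σ).toLinearMap

theorem permute_elem {n : ℕ} (σ : Equiv.Perm (Fin n)) (h : Fin n → L) :
    permute σ (elemTensor L n h) = elemTensor L n (fun i => h (σ.symm i)) :=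
  PiTensorProduct.reindex_tprod σ h

theorem inner_permute {n : ℕ} (σ : Equiv.Perm (Fin n)) (x : TensorPow L n) (h : Fin n → L) :
    ⟪permute σ x, elemTensor L n h⟫ = ⟪x, elemTensor L n (h ∘ σ)⟫ := by
  have : (innerₗ (TensorPow L n)).flip (elemTensor L n h) ∘ₗ permute σ =
      (innerₗ (TensorPow L n)).flip (elemTensor L n (h ∘ σ)) := by
    refine TensorPow.hom_ext fun k => ?_
    change ⟪permute σ (elemTensor L n k), elemTensor L n h⟫ = ⟪elemTensor L n k, _⟫
    rw [permute_elem, inner_elem, inner_elem, ← Equiv.prod_comp σ]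
    simp
  exact LinearMap.congr_fun this x

variable (L) in
/-- The algebraic `n`-fold symmetric tensors: the tensors fixed by all permutations. -/
def SymTensor (n : ℕ) : Submodule ℝ (TensorPow L n) :=
  ⨅ σ : Equiv.Perm (Fin n), LinearMap.eqLocus (permute σ) LinearMap.id

theorem mem_symTensor {n : ℕ} {x : TensorPow L n} :
    x ∈ SymTensor L n ↔ ∀ σ : Equiv.Perm (Fin n), permute σ x = x := by
  simp [SymTensor, Submodule.mem_iInf]

theorem mem_symTensor_iff_inner {n : ℕ} {x : TensorPow L n} :
    x ∈ SymTensor L n ↔ ∀ (σ : Equiv.Perm (Fin n)) (h : Fin n → L),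
      ⟪x, elemTensor L n (h ∘ σ)⟫ = ⟪x, elemTensor L n h⟫ := by
  rw [mem_symTensor]
  refine forall_congr' fun σ => ⟨fun H h => ?_, fun H => TensorPow.ext_inner fun h => ?_⟩
  · rw [← inner_permute, H]
  · rw [inner_permute, H]

/-- The symmetrizer `(1 / n!) ∑_σ σ`, the orthogonal projection onto the symmetric tensors. -/
def symmetrize (n : ℕ) : TensorPow L n →ₗ[ℝ] SymTensor L n :=
  LinearMap.codRestrict (SymTensor L n)
    ((n.factorial : ℝ)⁻¹ • ∑ σ : Equiv.Perm (Fin n), permute σ) (fun x => by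
      rw [mem_symTensor_iff_inner]
      intro τ h
      simp only [LinearMap.smul_apply, LinearMap.sum_apply, inner_smul_left, sum_inner,
        inner_permute]
      congr 1
      exact Fintype.sum_equiv (Equiv.mulLeft τ) _ _ fun σ => rfl)

theorem inner_symmetrize {n : ℕ} (x : TensorPow L n) (h : Fin n → L) :
    ⟪(symmetrize n x : TensorPow L n), elemTensor L n h⟫ =
      (n.factorial : ℝ)⁻¹ * ∑ σ : Equiv.Perm (Fin n), ⟪x, elemTensor L n (h ∘ σ)⟫ := by
  simp [symmetrize, inner_smul_left, sum_inner, inner_permute]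

/-- `k ↦ (x ↦ k ⊗ x)`. -/
def tensorCons (n : ℕ) : L →ₗ[ℝ] TensorPow L n →ₗ[ℝ] TensorPow L (n + 1) where
  toFun k := TensorPow.lift ((elemTensor L (n + 1)).curryLeft k)
  map_add' k l := TensorPow.hom_ext fun h => by
    simp [TensorPow.lift_elem, -MultilinearMap.curryLeft_apply]
  map_smul' c k := TensorPow.hom_ext fun h => by
    simp [TensorPow.lift_elem, -MultilinearMap.curryLeft_apply]

theorem tensorCons_elem {n : ℕ} (k : L) (h : Fin n → L) :
    tensorCons n k (elemTensor L n h) = elemTensor L (n + 1) (Fin.cons k h) :=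
  TensorPow.lift_elem _ _

/-- Contraction of the first factor: `k ↦ (h₀ ⊗ h₁ ⊗ ⋯ ⊗ hₙ ↦ ⟪k, h₀⟫ h₁ ⊗ ⋯ ⊗ hₙ)`. -/
def contract (n : ℕ) : L →ₗ[ℝ] TensorPow L (n + 1) →ₗ[ℝ] TensorPow L n where
  toFun k := TensorPow.lift (LinearMap.uncurryLeft ((innerₗ L k).smulRight (elemTensor L n)))
  map_add' k l := TensorPow.hom_ext fun h => by
    simp [TensorPow.lift_elem, add_smul]
  map_smul' c k := TensorPow.hom_ext fun h => by
    simp [TensorPow.lift_elem, mul_smul]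

theorem contract_elem {n : ℕ} (k : L) (h : Fin (n + 1) → L) :
    contract n k (elemTensor L (n + 1) h) = ⟪k, h 0⟫ • elemTensor L n (Fin.tail h) :=
  TensorPow.lift_elem _ _

theorem inner_tensorCons {n : ℕ} (k : L) (x : TensorPow L n) (h : Fin (n + 1) → L) :
    ⟪tensorCons n k x, elemTensor L (n + 1) h⟫ = ⟪k, h 0⟫ * ⟪x, elemTensor L n (Fin.tail h)⟫ := by
  have : (innerₗ (TensorPow L (n + 1))).flip (elemTensor L (n + 1) h) ∘ₗ tensorCons n k =
      ⟪k, h 0⟫ • (innerₗ (TensorPow L n)).flip (elemTensor L n (Fin.tail h)) := by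
    refine TensorPow.hom_ext fun u => ?_
    change ⟪tensorCons n k (elemTensor L n u), elemTensor L (n + 1) h⟫ =
      ⟪k, h 0⟫ * ⟪elemTensor L n u, _⟫
    rw [tensorCons_elem, inner_elem, inner_elem, Fin.prod_univ_succ]
    rfl
  exact LinearMap.congr_fun this x

theorem inner_contract {n : ℕ} (k : L) (x : TensorPow L (n + 1)) (h : Fin n → L) :
    ⟪contract n k x, elemTensor L n h⟫ = ⟪x, elemTensor L (n + 1) (Fin.cons k h)⟫ := by
  have : (innerₗ (TensorPow L n)).flip (elemTensor L n h) ∘ₗ contract n k =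
      (innerₗ (TensorPow L (n + 1))).flip (elemTensor L (n + 1) (Fin.cons k h)) := by
    refine TensorPow.hom_ext fun u => ?_
    change ⟪contract n k (elemTensor L (n + 1) u), elemTensor L n h⟫ =
      ⟪elemTensor L (n + 1) u, _⟫
    rw [contract_elem, inner_smul_left, inner_elem, inner_elem, Fin.prod_univ_succ]
    simp [Fin.tail, real_inner_comm]
  exact LinearMap.congr_fun this x

theorem contract_mem {n : ℕ} (k : L) {x : TensorPow L (n + 1)} (hx : x ∈ SymTensor L (n + 1)) :
    contract n k x ∈ SymTensor L n := by
  rw [mem_symTensor_iff_inner] at hx ⊢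
  intro σ h
  rw [inner_contract, inner_contract, ← hx (Equiv.Perm.decomposeFin.symm (0, σ)) (Fin.cons k h)]
  congr 2
  ext i
  refine Fin.cases ?_ (fun j => ?_) i <;> simp

/-- Creation from `n` to `n + 1` particles: `a*(k) x = √(n + 1) Sym (k ⊗ x)`. -/
def creN (n : ℕ) : L →ₗ[ℝ] SymTensor L n →ₗ[ℝ] SymTensor L (n + 1) where
  toFun k := √(n + 1 : ℝ) • (symmetrize (n + 1) ∘ₗ tensorCons n k ∘ₗ (SymTensor L n).subtype)
  map_add' k l := by ext x; simp
  map_smul' c k := by ext x; simp [smul_comm c]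

/-- Annihilation from `n + 1` to `n` particles: `a(k) x = √(n + 1) (⟪k, ·⟫ ⊗ 1 ⊗ ⋯ ⊗ 1) x`. -/
def annN (n : ℕ) : L →ₗ[ℝ] SymTensor L (n + 1) →ₗ[ℝ] SymTensor L n where
  toFun k := √(n + 1 : ℝ) • (contract n k).restrict (fun _ hx => contract_mem k hx)
  map_add' k l := by ext x; simp
  map_smul' c k := by ext x; simp [smul_comm c]


theorem inner_annN {n : ℕ} (k : L) (x : SymTensor L (n + 1)) (h : Fin n → L) :
    ⟪(annN n k x : TensorPow L n), elemTensor L n h⟫ =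
      √(n + 1 : ℝ) * ⟪(x : TensorPow L (n + 1)), elemTensor L (n + 1) (Fin.cons k h)⟫ := by
  rw [← inner_contract, ← real_inner_smul_left]
  rfl

theorem inner_eq_of_perm {n : ℕ} (x : SymTensor L n) (σ : Equiv.Perm (Fin n)) {h h' : Fin n → L}
    (hh : ∀ i, h' i = h (σ i)) :
    ⟪(x : TensorPow L n), elemTensor L n h'⟫ = ⟪(x : TensorPow L n), elemTensor L n h⟫ := by
  obtain rfl : h' = h ∘ σ := funext hh
  exact mem_symTensor_iff_inner.1 x.2 σ h

theorem inner_creN {n : ℕ} (k : L) (x : SymTensor L n) (h : Fin (n + 1) → L) :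
    √(n + 1 : ℝ) * ⟪(creN n k x : TensorPow L (n + 1)), elemTensor L (n + 1) h⟫ =
      ∑ p, ⟪k, h p⟫ * ⟪(x : TensorPow L n), elemTensor L n fun i => h (Equiv.swap 0 p i.succ)⟫ := by
  have h0 : (creN n k x : TensorPow L (n + 1)) =
      √(n + 1 : ℝ) • (symmetrize (n + 1) (tensorCons n k x) : TensorPow L (n + 1)) := rfl
  have hs : √(n + 1 : ℝ) * √(n + 1 : ℝ) = n + 1 := Real.mul_self_sqrt (by positivity)
  rw [h0, real_inner_smul_left, ← mul_assoc, hs, inner_symmetrize,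
    ← Equiv.sum_comp Equiv.Perm.decomposeFin.symm, Fintype.sum_prod_type]
  have key : ∀ (p : Fin (n + 1)) (e : Equiv.Perm (Fin n)),
      ⟪tensorCons n k (x : TensorPow L n),
        elemTensor L (n + 1) (h ∘ Equiv.Perm.decomposeFin.symm (p, e))⟫ =
      ⟪k, h p⟫ * ⟪(x : TensorPow L n), elemTensor L n fun i => h (Equiv.swap 0 p i.succ)⟫ := by
    intro p e
    rw [inner_tensorCons]
    congr 1
    · simp
    · exact inner_eq_of_perm x e fun i => by simp [Fin.tail]
  simp only [key, Finset.sum_const, Finset.card_univ, Fintype.card_perm, Fintype.card_fin,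
    nsmul_eq_mul, ← Finset.mul_sum]
  rw [Nat.factorial_succ]
  have : (n.factorial : ℝ) ≠ 0 := by positivity
  push_cast
  field_simp

theorem inner_symmetrize_left {n : ℕ} (x : TensorPow L n) (y : SymTensor L n) :
    ⟪(symmetrize n x : TensorPow L n), y⟫ = ⟪x, y⟫ := by
  have hp : ∀ (σ : Equiv.Perm (Fin n)) (z : TensorPow L n),
      ⟪permute σ x, z⟫ = ⟪x, permute σ.symm z⟫ := fun σ z => by
    have : innerₗ (TensorPow L n) (permute σ x) =
        innerₗ (TensorPow L n) x ∘ₗ permute σ.symm := by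
      refine TensorPow.hom_ext fun h => ?_
      change ⟪permute σ x, elemTensor L n h⟫ = ⟪x, permute σ.symm (elemTensor L n h)⟫
      rw [inner_permute, permute_elem]
      rfl
    exact LinearMap.congr_fun this z
  have hn : (n.factorial : ℝ) ≠ 0 := by positivity
  change ⟪((n.factorial : ℝ)⁻¹ • ∑ σ : Equiv.Perm (Fin n), permute σ) x, (y : TensorPow L n)⟫ = _
  simp only [LinearMap.smul_apply, LinearMap.sum_apply, real_inner_smul_left, sum_inner, hp,
    mem_symTensor.1 y.2, Finset.sum_const, Finset.card_univ, Fintype.card_perm, Fintype.card_fin,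
    nsmul_eq_mul]
  field_simp

theorem inner_tensorCons_left {n : ℕ} (k : L) (x : TensorPow L n) (y : TensorPow L (n + 1)) :
    ⟪tensorCons n k x, y⟫ = ⟪x, contract n k y⟫ := by
  have : innerₗ (TensorPow L (n + 1)) (tensorCons n k x) =
      innerₗ (TensorPow L n) x ∘ₗ contract n k := by
    refine TensorPow.hom_ext fun h => ?_
    change ⟪tensorCons n k x, elemTensor L (n + 1) h⟫ = ⟪x, contract n k (elemTensor L (n + 1) h)⟫
    rw [inner_tensorCons, contract_elem, real_inner_smul_right]
  exact LinearMap.congr_fun this y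

/-- Creation and annihilation are formally adjoint. -/
theorem inner_creN_left {n : ℕ} (k : L) (x : SymTensor L n) (y : SymTensor L (n + 1)) :
    ⟪creN n k x, y⟫ = ⟪x, annN n k y⟫ := by
  change ⟪√(n + 1 : ℝ) • (symmetrize (n + 1) (tensorCons n k x) : TensorPow L (n + 1)),
    (y : TensorPow L (n + 1))⟫ = ⟪(x : TensorPow L n), √(n + 1 : ℝ) • contract n k y⟫
  rw [real_inner_smul_left, real_inner_smul_right, inner_symmetrize_left, inner_tensorCons_left]

theorem annN_comm {n : ℕ} (k l : L) (x : SymTensor L (n + 1 + 1)) :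
    annN n k (annN (n + 1) l x) = annN n l (annN (n + 1) k x) := by
  refine Subtype.ext (TensorPow.ext_inner fun h => ?_)
  rw [inner_annN, inner_annN, inner_annN, inner_annN]
  congr 2
  refine inner_eq_of_perm x (Equiv.swap 0 1) fun i => ?_
  refine Fin.cases ?_ (fun j => Fin.cases ?_ (fun j => ?_) j) i
  · simp
  · rw [Fin.succ_zero_eq_one, Equiv.swap_apply_right]
    exact Fin.cons_succ (α := fun _ => L) l (Fin.cons k h) 0
  · have : Equiv.swap (0 : Fin (n + 1 + 1)) 1 j.succ.succ = j.succ.succ :=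
      Equiv.swap_apply_of_ne_of_ne (Fin.succ_ne_zero _) (by
        rw [← Fin.succ_zero_eq_one]; exact fun h => Fin.succ_ne_zero _ (Fin.succ_injective _ h))
    rw [this]
    simp

theorem creN_comm {n : ℕ} (k l : L) (x : SymTensor L n) :
    creN (n + 1) k (creN n l x) = creN (n + 1) l (creN n k x) :=
  ext_inner_right ℝ fun y => by
    simp only [inner_creN_left, annN_comm]

theorem annN_creN_zero (k l : L) (x : SymTensor L 0) :
    annN 0 k (creN 0 l x) = ⟪k, l⟫ • x := by
  refine Subtype.ext (TensorPow.ext_inner fun h => ?_)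
  rw [inner_annN, inner_creN, Submodule.coe_smul, real_inner_smul_left, Fin.sum_univ_succ]
  simp [real_inner_comm, Subsingleton.elim _ Fin.elim0]

/-- The canonical commutation relation on `n + 1` particles. -/
theorem annN_creN {n : ℕ} (k l : L) (x : SymTensor L (n + 1)) :
    annN (n + 1) k (creN (n + 1) l x) = creN n l (annN n k x) + ⟪k, l⟫ • x := by
  refine Subtype.ext (TensorPow.ext_inner fun h => ?_)
  have hs : √((n : ℝ) + 1) ≠ 0 := by positivity
  have e1 := inner_creN l (annN n k x) h
  simp only [inner_annN] at e1
  rw [inner_annN, Submodule.coe_add, Submodule.coe_smul, inner_add_left, real_inner_smul_left,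
    inner_creN, Fin.sum_univ_succ, add_comm]
  congr 1
  · apply mul_left_cancel₀ hs
    rw [e1, Finset.mul_sum]
    refine Finset.sum_congr rfl fun p _ => ?_
    rw [mul_left_comm, Fin.cons_succ]
    congr 2
    refine inner_eq_of_perm x (Equiv.swap 0 p) fun i => ?_
    have hc : ∀ j : Fin (n + 1), j ≠ 0 →
        (Fin.cons k fun i : Fin n => h (Equiv.swap 0 p i.succ) : Fin (n + 1) → L) j =
          h (Equiv.swap 0 p j) := fun j hj => by
      obtain ⟨q, rfl⟩ := Fin.exists_succ_eq.2 hj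
      simp
    by_cases hi : i = p
    · subst hi
      simp
    · rw [hc _ (fun h0 => hi (by
        simpa using congrArg (Equiv.swap 0 p) h0)), Equiv.swap_apply_of_ne_of_ne (Fin.succ_ne_zero _)
          (fun h => hi (Fin.succ_injective _ h))]
      simp
  · simp [real_inner_comm]


end Tensor

section CCR

variable (L : Type*) [NormedAddCommGroup L] [InnerProductSpace ℝ L]

/-- The canonical commutation relations between the generators `a(h) = (h, 0)` and
`a*(h) = (0, h)`. -/
inductive CCRRel : TensorAlgebra ℝ (L × L) → TensorAlgebra ℝ (L × L) → Prop
  | ann (h k : L) : CCRRel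
      (TensorAlgebra.ι ℝ (h, (0 : L)) * TensorAlgebra.ι ℝ (k, (0 : L)))
      (TensorAlgebra.ι ℝ (k, (0 : L)) * TensorAlgebra.ι ℝ (h, (0 : L)))
  | cre (h k : L) : CCRRel
      (TensorAlgebra.ι ℝ ((0 : L), h) * TensorAlgebra.ι ℝ ((0 : L), k))
      (TensorAlgebra.ι ℝ ((0 : L), k) * TensorAlgebra.ι ℝ ((0 : L), h))
  | comm (h k : L) : CCRRel
      (TensorAlgebra.ι ℝ (h, (0 : L)) * TensorAlgebra.ι ℝ ((0 : L), k))
      (TensorAlgebra.ι ℝ ((0 : L), k) * TensorAlgebra.ι ℝ (h, (0 : L)) +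
        algebraMap ℝ (TensorAlgebra ℝ (L × L)) ⟪h, k⟫)

/-- The CCR algebra over `L`: the unital real algebra generated by elements `a(h)`, `a*(h)`
depending linearly on `h ∈ L`, subject to `[a(h), a(k)] = 0`, `[a*(h), a*(k)] = 0` and
`[a(h), a*(k)] = ⟪h, k⟫ 1`. -/
def CCR : Type _ := RingQuot (CCRRel L)

instance : Ring (CCR L) := inferInstanceAs (Ring (RingQuot (CCRRel L)))

instance : Algebra ℝ (CCR L) := inferInstanceAs (Algebra ℝ (RingQuot (CCRRel L)))

namespace CCR

/-- The quotient map from the free algebra. -/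
def mk : TensorAlgebra ℝ (L × L) →ₐ[ℝ] CCR L := RingQuot.mkAlgHom ℝ (CCRRel L)

/-- The generators `a(h)`. -/
def ann : L →ₗ[ℝ] CCR L :=
  (mk L).toLinearMap ∘ₗ TensorAlgebra.ι ℝ ∘ₗ LinearMap.inl ℝ L L

/-- The generators `a*(h)`. -/
def cre : L →ₗ[ℝ] CCR L :=
  (mk L).toLinearMap ∘ₗ TensorAlgebra.ι ℝ ∘ₗ LinearMap.inr ℝ L L

variable {L}

theorem mk_rel {x y : TensorAlgebra ℝ (L × L)} (h : CCRRel L x y) : mk L x = mk L y :=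
  RingQuot.mkAlgHom_rel ℝ h

theorem ann_ann (h k : L) : ann L h * ann L k = ann L k * ann L h := by
  simpa [ann] using mk_rel (CCRRel.ann h k)

theorem cre_cre (h k : L) : cre L h * cre L k = cre L k * cre L h := by
  simpa [cre] using mk_rel (CCRRel.cre h k)

theorem ann_cre (h k : L) :
    ann L h * cre L k = cre L k * ann L h + algebraMap ℝ (CCR L) ⟪h, k⟫ := by
  simpa [ann, cre] using mk_rel (CCRRel.comm h k)

variable {A : Type*} [Ring A] [Algebra ℝ A]

/-- The universal property of the CCR algebra. -/
def lift (f g : L →ₗ[ℝ] A) (hff : ∀ h k, f h * f k = f k * f h)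
    (hgg : ∀ h k, g h * g k = g k * g h)
    (hfg : ∀ h k, f h * g k = g k * f h + algebraMap ℝ A ⟪h, k⟫) : CCR L →ₐ[ℝ] A :=
  RingQuot.liftAlgHom ℝ (s := CCRRel L) ⟨TensorAlgebra.lift ℝ (f.coprod g), fun x y h => by
    induction h with
    | ann h k => simpa using hff h k
    | cre h k => simpa using hgg h k
    | comm h k => simpa using hfg h k⟩

theorem lift_mk (f g : L →ₗ[ℝ] A) (hff : ∀ h k, f h * f k = f k * f h)
    (hgg : ∀ h k, g h * g k = g k * g h)
    (hfg : ∀ h k, f h * g k = g k * f h + algebraMap ℝ A ⟪h, k⟫) (x : TensorAlgebra ℝ (L × L)) :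
    lift f g hff hgg hfg (mk L x) = TensorAlgebra.lift ℝ (f.coprod g) x :=
  RingQuot.liftAlgHom_mkAlgHom_apply _ _ _ _

theorem lift_ann (f g : L →ₗ[ℝ] A) (hff : ∀ h k, f h * f k = f k * f h)
    (hgg : ∀ h k, g h * g k = g k * g h)
    (hfg : ∀ h k, f h * g k = g k * f h + algebraMap ℝ A ⟪h, k⟫) (h : L) :
    lift f g hff hgg hfg (ann L h) = f h :=
  (lift_mk f g hff hgg hfg _).trans (by simp)

theorem lift_cre (f g : L →ₗ[ℝ] A) (hff : ∀ h k, f h * f k = f k * f h)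
    (hgg : ∀ h k, g h * g k = g k * g h)
    (hfg : ∀ h k, f h * g k = g k * f h + algebraMap ℝ A ⟪h, k⟫) (h : L) :
    lift f g hff hgg hfg (cre L h) = g h :=
  (lift_mk f g hff hgg hfg _).trans (by simp)

theorem hom_ext {φ ψ : CCR L →ₐ[ℝ] A} (ha : ∀ h, φ (ann L h) = ψ (ann L h))
    (hc : ∀ h, φ (cre L h) = ψ (cre L h)) : φ = ψ := by
  refine RingQuot.ringQuot_ext' ℝ φ ψ (TensorAlgebra.hom_ext ?_)
  refine LinearMap.prod_ext (LinearMap.ext ha) (LinearMap.ext hc)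

/-- The anti-automorphism exchanging `a(h)` and `a*(h)`. -/
def starHom : CCR L →ₐ[ℝ] (CCR L)ᵐᵒᵖ :=
  lift ((MulOpposite.opLinearEquiv ℝ).toLinearMap ∘ₗ cre L)
    ((MulOpposite.opLinearEquiv ℝ).toLinearMap ∘ₗ ann L)
    (fun h k => MulOpposite.unop_injective (cre_cre k h))
    (fun h k => MulOpposite.unop_injective (ann_ann k h))
    (fun h k => MulOpposite.unop_injective (by
      have := ann_cre k h
      rw [real_inner_comm] at this
      exact this))

theorem starHom_starHom : (AlgHom.opComm starHom).comp starHom = AlgHom.id ℝ (CCR L) := by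
  refine hom_ext (fun h => ?_) (fun h => ?_) <;>
  simp [starHom, lift_ann, lift_cre, AlgHom.opComm]

/-- The `*`-algebra structure of the CCR algebra, with `a(h)* = a*(h)`. -/
instance : StarRing (CCR L) where
  star x := (starHom x).unop
  star_involutive x := AlgHom.congr_fun starHom_starHom x
  star_mul x y := by rw [map_mul, MulOpposite.unop_mul]
  star_add x y := by rw [map_add, MulOpposite.unop_add]

theorem star_ann (h : L) : star (ann L h) = cre L h :=
  congrArg MulOpposite.unop (lift_ann _ _ _ _ _ h)

theorem star_cre (h : L) : star (cre L h) = ann L h :=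
  congrArg MulOpposite.unop (lift_cre _ _ _ _ _ h)

/-- A state on the CCR algebra: a normalized, positive, hermitian linear functional. (On a real
`*`-algebra hermiticity does not follow from positivity.) -/
structure IsState (ω : CCR L →ₗ[ℝ] ℝ) : Prop where
  map_one : ω 1 = 1
  nonneg : ∀ A, 0 ≤ ω (star A * A)
  map_star : ∀ A, ω (star A) = ω A

/-- Fock states: `ω(a(h) a*(k)) = ⟪h, k⟫` and the vacuum property `ω(a*(h) a(h)) = 0`. -/
structure IsFockState (ω : CCR L →ₗ[ℝ] ℝ) : Prop where
  isState : IsState ω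
  ann_cre : ∀ h k, ω (ann L h * cre L k) = ⟪h, k⟫
  cre_ann : ∀ h, ω (cre L h * ann L h) = 0

end CCR

end CCR

section Fock

variable (L : Type*) [NormedAddCommGroup L] [InnerProductSpace ℝ L]

/-- The symmetric Fock space `Γ_sym(L)`: the Hilbert space direct sum over `n` of the `n`-fold
symmetric Hilbert space tensor powers of `L`. -/
abbrev Fock : Type _ := lp (fun n : ℕ => UniformSpace.Completion (SymTensor L n)) 2

/-- The algebraic symmetric Fock space: finite sequences of algebraic symmetric tensors. -/
abbrev FockAlg : Type _ := ⨁ n : ℕ, SymTensor L n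

variable {L}

/-- The inclusion of the algebraic symmetric Fock space into `Γ_sym(L)`. -/
def FockAlg.toFock : FockAlg L →ₗ[ℝ] Fock L where
  toFun x := ⟨fun n => ((x n : SymTensor L n) : UniformSpace.Completion (SymTensor L n)),
    (memℓp_zero (Set.Finite.subset (DFinsupp.finite_support x) fun n hn h => hn (by
      rw [h, UniformSpace.Completion.coe_zero]))).of_exponent_ge zero_le⟩
  map_add' x y := by ext n; exact UniformSpace.Completion.coe_add _ _
  map_smul' c x := by ext n; exact UniformSpace.Completion.coe_smul _ _

theorem FockAlg.toFock_injective : Function.Injective (FockAlg.toFock (L := L)) := by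
  intro x y h
  refine DFinsupp.ext fun n => UniformSpace.Completion.coe_injective _ ?_
  exact congrFun (congrArg Subtype.val h) n

/-- The inclusion of the `n`-particle vectors. -/
def nPart (n : ℕ) : SymTensor L n →ₗ[ℝ] FockAlg L :=
  DirectSum.lof ℝ ℕ (fun n => SymTensor L n) n

/-- The linear map given by its restrictions to the `n`-particle vectors. -/
def fromParts {E : Type*} [AddCommGroup E] [Module ℝ E] (f : ∀ n, SymTensor L n →ₗ[ℝ] E) :
    FockAlg L →ₗ[ℝ] E :=
  DirectSum.toModule ℝ ℕ E f

theorem fromParts_nPart {E : Type*} [AddCommGroup E] [Module ℝ E]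
    (f : ∀ n, SymTensor L n →ₗ[ℝ] E) (n : ℕ) (x : SymTensor L n) :
    fromParts f (nPart n x) = f n x :=
  DirectSum.toModule_lof (M := fun n => SymTensor L n) ℝ n x

theorem FockAlg.hom_ext {E : Type*} [AddCommGroup E] [Module ℝ E] {f g : FockAlg L →ₗ[ℝ] E}
    (H : ∀ n x, f (nPart n x) = g (nPart n x)) : f = g :=
  DirectSum.linearMap_ext ℝ fun n => LinearMap.ext fun x => H n x

/-- The creation operator `a*(k)` on finite particle vectors. -/
def creOp : L →ₗ[ℝ] Module.End ℝ (FockAlg L) where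
  toFun k := fromParts fun n => nPart (n + 1) ∘ₗ creN n k
  map_add' k l := FockAlg.hom_ext fun n x => by simp [fromParts_nPart]
  map_smul' c k := FockAlg.hom_ext fun n x => by simp [fromParts_nPart]

/-- The annihilation operator `a(k)` on finite particle vectors; it kills the vacuum. -/
def annOp : L →ₗ[ℝ] Module.End ℝ (FockAlg L) where
  toFun k := fromParts fun
    | 0 => 0
    | n + 1 => nPart n ∘ₗ annN n k
  map_add' k l := FockAlg.hom_ext fun n x => by cases n <;> simp [fromParts_nPart]
  map_smul' c k := FockAlg.hom_ext fun n x => by cases n <;> simp [fromParts_nPart]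

theorem creOp_nPart (k : L) (n : ℕ) (x : SymTensor L n) :
    creOp k (nPart n x) = nPart (n + 1) (creN n k x) :=
  fromParts_nPart _ n x

theorem annOp_nPart_zero (k : L) (x : SymTensor L 0) : annOp k (nPart 0 x) = 0 :=
  fromParts_nPart _ 0 x

theorem annOp_nPart_succ (k : L) (n : ℕ) (x : SymTensor L (n + 1)) :
    annOp k (nPart (n + 1) x) = nPart n (annN n k x) :=
  fromParts_nPart _ (n + 1) x

/-- The Fock representation `π_F` of the CCR algebra by operators on finite particle vectors,
`π_F(a(k)) = a(k)` and `π_F(a*(k)) = a*(k)`. -/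
def fockRep : CCR L →ₐ[ℝ] Module.End ℝ (FockAlg L) :=
  CCR.lift (A := Module.End ℝ (FockAlg L)) annOp creOp
    (fun h k => FockAlg.hom_ext fun n x => by
      rw [Module.End.mul_apply, Module.End.mul_apply]
      match n, x with
      | 0, x => rw [annOp_nPart_zero, annOp_nPart_zero, map_zero, map_zero]
      | 1, x => simp only [annOp_nPart_succ, annOp_nPart_zero]
      | n + 1 + 1, x => simp only [annOp_nPart_succ, annN_comm h k])
    (fun h k => FockAlg.hom_ext fun n x => by
      rw [Module.End.mul_apply, Module.End.mul_apply]
      simp only [creOp_nPart, creN_comm h k])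
    (fun h k => FockAlg.hom_ext fun n x => by
      rw [LinearMap.add_apply, Module.End.mul_apply, Module.End.mul_apply,
        Module.algebraMap_end_apply]
      match n, x with
      | 0, x => rw [annOp_nPart_zero, creOp_nPart, annOp_nPart_succ, annN_creN_zero, map_zero,
          map_smul, zero_add]
      | n + 1, x => rw [annOp_nPart_succ, creOp_nPart, creOp_nPart, annOp_nPart_succ, annN_creN,
          map_add, map_smul])

theorem fockRep_ann (k : L) : fockRep (CCR.ann L k) = annOp k := CCR.lift_ann _ _ _ _ _ k

theorem fockRep_cre (k : L) : fockRep (CCR.cre L k) = creOp k := CCR.lift_cre _ _ _ _ _ k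

/-- `π_F(A)` as an unbounded operator in `Γ_sym(L)`, with the finite particle vectors as domain. -/
def fockOp (A : CCR L) : Fock L →ₗ.[ℝ] Fock L where
  domain := LinearMap.range (FockAlg.toFock (L := L))
  toFun := FockAlg.toFock ∘ₗ fockRep A ∘ₗ
    (LinearEquiv.ofInjective FockAlg.toFock FockAlg.toFock_injective).symm.toLinearMap

/-- The tensor power `k ⊗ ⋯ ⊗ k`. -/
def powTensor (n : ℕ) (k : L) : SymTensor L n :=
  ⟨elemTensor L n fun _ => k, mem_symTensor.2 fun σ => permute_elem σ _⟩

theorem norm_powTensor_sq (n : ℕ) (k : L) : ‖powTensor n k‖ ^ 2 = (‖k‖ ^ 2) ^ n := by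
  rw [← real_inner_self_eq_norm_sq, ← real_inner_self_eq_norm_sq]
  exact (inner_elem _ _).trans (by simp)

variable (L) in
/-- The vacuum vector `1 ∈ ℝ = L^{⊗ 0}`. -/
def vacuum : FockAlg L := nPart 0 (powTensor 0 0)

variable (L) in
/-- The vacuum state `A ↦ ⟪vacuum, π_F(A) vacuum⟫` on the CCR algebra. -/
def fockState : CCR L →ₗ[ℝ] ℝ :=
  innerₗ (Fock L) (vacuum L).toFock ∘ₗ FockAlg.toFock ∘ₗ
    (LinearMap.applyₗ (vacuum L)) ∘ₗ fockRep.toLinearMap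

/-- The exponential vector `e^k = ∑ₙ k^{⊗ n} / √(n!)`. -/
def expVec (k : L) : Fock L :=
  ⟨fun n => (((√(n.factorial : ℝ))⁻¹ • powTensor n k : SymTensor L n) :
    UniformSpace.Completion (SymTensor L n)), by
    refine memℓp_gen ?_
    refine (Real.summable_pow_div_factorial (‖k‖ ^ 2)).congr fun n => ?_
    refine Eq.trans ?_ (congrArg (· ^ (ENNReal.toReal 2))
      (UniformSpace.Completion.norm_coe ((√(n.factorial : ℝ))⁻¹ • powTensor n k)).symm)
    rw [norm_smul, ENNReal.toReal_ofNat, Real.rpow_two, mul_pow,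
      norm_powTensor_sq, norm_inv, inv_pow, Real.norm_eq_abs, sq_abs,
      Real.sq_sqrt (by positivity), div_eq_inv_mul]⟩

end Fock

section Gaussian

variable {L : Type*} [NormedAddCommGroup L] [InnerProductSpace ℝ L]
  {Ω : Type*} [MeasurableSpace Ω] {P : Measure Ω}

/-- A Gaussian field: a linear map `Φ : L → L²(Ω, P)` such that `(Φ(h))_{h ∈ L}` is a centered
Gaussian process with `E(Φ(h) Φ(k)) = ⟪h, k⟫`. -/
structure IsGaussianField (Φ : L →ₗ[ℝ] Lp ℝ 2 P) : Prop where
  gaussian : IsGaussianProcess (fun h ω => Φ h ω) P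
  mean : ∀ h, ∫ ω, Φ h ω ∂P = 0
  cov : ∀ h k, ∫ ω, Φ h ω * Φ k ω ∂P = ⟪h, k⟫

/-- The σ-algebra of `Ω` is generated by the field, up to null sets. This does not depend on the
representatives chosen for the classes `Φ h`. -/
def IsGeneratedBy (Φ : L →ₗ[ℝ] Lp ℝ 2 P) : Prop :=
  ∀ A : Set Ω, MeasurableSet A →
    ∃ B : Set Ω, MeasurableSet[⨆ h : L, MeasurableSpace.comap (Φ h) inferInstance] B ∧ A =ᵐ[P] B

/-- The random variable `p(Φ(h₁), …, Φ(hₙ))`. -/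
def polyFun (Φ : L →ₗ[ℝ] Lp ℝ 2 P) {n : ℕ} (h : Fin n → L) (p : MvPolynomial (Fin n) ℝ) (ω : Ω) : ℝ :=
  MvPolynomial.eval (fun i => Φ (h i) ω) p

/-- The space `𝒟` of polynomial fields: the span in `L²` of the `p(Φ(h₁), …, Φ(hₙ))`. -/
def polyDomain (Φ : L →ₗ[ℝ] Lp ℝ 2 P) : Submodule ℝ (Lp ℝ 2 P) :=
  Submodule.span ℝ {F | ∃ (n : ℕ) (h : Fin n → L) (p : MvPolynomial (Fin n) ℝ),
    F =ᵐ[P] polyFun Φ h p}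

/-- The graph of the Malliavin derivative: the span of the pairs
`(p(Φ(h₁), …, Φ(hₙ)), ∑ⱼ (∂p/∂xⱼ)(Φ(h₁), …, Φ(hₙ)) ⊗ hⱼ)`. -/
def malliavinGraph (Φ : L →ₗ[ℝ] Lp ℝ 2 P) : Submodule ℝ (Lp ℝ 2 P × Lp L 2 P) :=
  Submodule.span ℝ {x | ∃ (n : ℕ) (h : Fin n → L) (p : MvPolynomial (Fin n) ℝ),
    x.1 =ᵐ[P] polyFun Φ h p ∧
    x.2 =ᵐ[P] fun ω => ∑ j, polyFun Φ h (MvPolynomial.pderiv j p) ω • h j}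

/-- The Malliavin derivative `T : L²(Ω, P) → L²(Ω, P) ⊗ L = L²(Ω → L, P)`, the unbounded operator
with graph `malliavinGraph Φ`. -/
def malliavin (Φ : L →ₗ[ℝ] Lp ℝ 2 P) : Lp ℝ 2 P →ₗ.[ℝ] Lp L 2 P :=
  (malliavinGraph Φ).toLinearPMap

/-- The Malliavin derivative in the direction `k`, `T_k F = ⟪T F, k⟫`. -/
def malliavinDir (Φ : L →ₗ[ℝ] Lp ℝ 2 P) (k : L) : Lp ℝ 2 P →ₗ.[ℝ] Lp ℝ 2 P :=
  ((innerSL ℝ k).compLpL 2 P).toLinearMap.compPMap (malliavin Φ)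

/-- Multiplication by `f`, with its natural domain in `L²`. -/
def mulOp (f : Lp ℝ 2 P) : Lp ℝ 2 P →ₗ.[ℝ] Lp ℝ 2 P where
  domain :=
    { carrier := {F | MemLp (fun ω => f ω * F ω) 2 P}
      add_mem' := fun {F G} hF hG => (hF.add hG).ae_eq (by
        filter_upwards [Lp.coeFn_add F G] with ω h
        rw [h, Pi.add_apply, Pi.add_apply, mul_add])
      zero_mem' := (MemLp.zero (ε := ℝ)).ae_eq (by
        filter_upwards [Lp.coeFn_zero ℝ 2 P] with ω h
        rw [h, Pi.zero_apply, mul_zero])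
      smul_mem' := fun c F hF => (hF.const_smul c).ae_eq (by
        filter_upwards [Lp.coeFn_smul c F] with ω h
        simp [h, mul_left_comm]) }
  toFun :=
    { toFun := fun F => MemLp.toLp (fun ω => f ω * (F : Lp ℝ 2 P) ω) F.2
      map_add' := fun F G => by
        rw [← MemLp.toLp_add]
        refine MemLp.toLp_congr _ _ ?_
        filter_upwards [Lp.coeFn_add (F : Lp ℝ 2 P) G] with ω h
        rw [Submodule.coe_add, h, Pi.add_apply, Pi.add_apply, mul_add]
      map_smul' := fun c F => by
        rw [RingHom.id_apply, ← MemLp.toLp_const_smul]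
        refine MemLp.toLp_congr _ _ ?_
        filter_upwards [Lp.coeFn_smul c (F : Lp ℝ 2 P)] with ω h
        simp [h, mul_left_comm] }

/-- The operator `W A W*` with its natural domain `{F | W* F ∈ dom A}`, for a unitary `W`. -/
def conjOp {H K : Type*} [NormedAddCommGroup H] [InnerProductSpace ℝ H] [NormedAddCommGroup K]
    [InnerProductSpace ℝ K] (W : H ≃ₗᵢ[ℝ] K) (A : H →ₗ.[ℝ] H) : K →ₗ.[ℝ] K where
  domain := A.domain.comap W.symm.toLinearEquiv.toLinearMap
  toFun := W.toLinearEquiv.toLinearMap ∘ₗ A.toFun ∘ₗ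
    W.symm.toLinearEquiv.toLinearMap.restrict (fun _ h => h)

end Gaussian

end BoseFock

end

open BoseFock

/-! Fock and Gaussian space carry two representations of the same algebra, each with a unit vector
killed by all `a(h)` and cyclic. Such a vector always gives the Fock state, so uniqueness of that
state forces the two to be isometric; no Hermite polynomials are needed.

Uniqueness (`CCR.IsFockState.unique`): positivity and `ω(a*(h) a(h)) = 0` give `ω(A a(h)) = 0` by
Cauchy–Schwarz, and hermiticity gives `ω(a*(h) A) = 0`. By normal ordering every element is a
polynomial in creators plus terms ending in an annihilator, so only `ω(1)` matters.

On polynomial fields the operators are `∂_k` and `Φ(k) - ∂_k`. Gaussian integration by parts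
(`expMoment_X_mul`) makes them formally adjoint. Hence a polynomial vanishing almost surely has
derivatives vanishing almost surely (`ev_dirDeriv_eq_zero`); this makes the operators well defined
and, testing against every direction, also the Malliavin derivative. The constant `1` is killed by
`∂_k` and is cyclic because `a*(k) + a(k)` acts as multiplication by `Φ(k)`. Equality of the vector
states gives the isometry `exists_isometry`, which intertwines the representations on the cyclic
vectors.

The isometry sends `e^k` to the normalized exponential because both vectors have squared norm
`exp(‖k‖²)` and the image of the first has the same inner product with the second
(`isometry_expVec`). Surjectivity and uniqueness of `W` rest on totality of the exponentials in `L²`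
(`eq_zero_of_integral_exp`): if `F` is orthogonal to all of them, the measures with densities `F⁺`
and `F⁻` give the field the same Laplace transforms, hence the same law, and agree because the field
generates the σ-algebra. The operator identities, domains included, are then read off from cyclicity
on both sides. -/

noncomputable section

namespace BoseFock

/-! ### Normal ordering and uniqueness of the Fock state -/

section CCRAlgebra

variable {L : Type*} [NormedAddCommGroup L] [InnerProductSpace ℝ L]

/-- Induction on the generators of the CCR algebra. -/
theorem CCR.induction {C : CCR L → Prop} (halg : ∀ r, C (algebraMap ℝ (CCR L) r))
    (hann : ∀ h, C (CCR.ann L h)) (hcre : ∀ h, C (CCR.cre L h))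
    (hmul : ∀ A B, C A → C B → C (A * B)) (hadd : ∀ A B, C A → C B → C (A + B)) (A : CCR L) :
    C A := by
  obtain ⟨x, rfl⟩ : ∃ x, CCR.mk L x = A := RingQuot.mkAlgHom_surjective ℝ (CCRRel L) A
  induction x using TensorAlgebra.induction with
  | algebraMap r => rw [AlgHom.commutes]; exact halg r
  | ι x =>
    have : CCR.mk L (TensorAlgebra.ι ℝ x) = CCR.ann L x.1 + CCR.cre L x.2 := by
      simp [CCR.ann, CCR.cre, ← map_add]
    rw [this]
    exact hadd _ _ (hann _) (hcre _)
  | mul x y hx hy => rw [map_mul]; exact hmul _ _ hx hy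
  | add x y hx hy => rw [map_add]; exact hadd _ _ hx hy

theorem CCR.star_algebraMap (r : ℝ) : star (algebraMap ℝ (CCR L) r) = algebraMap ℝ (CCR L) r :=
  congrArg MulOpposite.unop (AlgHom.commutes CCR.starHom r)

theorem CCR.star_smul (r : ℝ) (A : CCR L) : star (r • A) = r • star A := by
  rw [Algebra.smul_def, star_mul, CCR.star_algebraMap, ← Algebra.commutes, ← Algebra.smul_def]

variable (L) in
/-- The algebra generated by the creation operators. -/
def CCR.creAlg : Subalgebra ℝ (CCR L) := Algebra.adjoin ℝ (Set.range (CCR.cre L))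

variable (L) in
/-- The left ideal generated by the annihilation operators, as a subspace. -/
def CCR.annIdeal : Submodule ℝ (CCR L) :=
  Submodule.span ℝ {A | ∃ B h, A = B * CCR.ann L h}

theorem CCR.mul_mem_annIdeal (A : CCR L) {B : CCR L} (hB : B ∈ CCR.annIdeal L) :
    A * B ∈ CCR.annIdeal L := by
  induction hB using Submodule.span_induction with
  | mem x hx =>
    obtain ⟨B, h, rfl⟩ := hx
    exact Submodule.subset_span ⟨A * B, h, (mul_assoc _ _ _).symm⟩
  | zero => rw [mul_zero]; exact zero_mem _
  | add x y _ _ hx hy => rw [mul_add]; exact add_mem hx hy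
  | smul c x _ hx => rw [mul_smul_comm]; exact Submodule.smul_mem _ _ hx

/-- The commutator with `a(h)` is a derivation that sends the generators `a*(k)` to scalars, so it
preserves the algebra they generate. -/
theorem CCR.ann_mul_sub_mem (h : L) {C : CCR L} (hC : C ∈ CCR.creAlg L) :
    CCR.ann L h * C - C * CCR.ann L h ∈ CCR.creAlg L := by
  induction hC using Algebra.adjoin_induction with
  | mem x hx =>
    obtain ⟨k, rfl⟩ := hx
    rw [CCR.ann_cre, add_sub_cancel_left]
    exact Subalgebra.algebraMap_mem _ _
  | algebraMap r => rw [Algebra.commutes, sub_self]; exact zero_mem _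
  | add x y _ _ hx hy =>
    rw [mul_add, add_mul, add_sub_add_comm]; exact add_mem hx hy
  | mul x y hx' hy' hx hy =>
    have : CCR.ann L h * (x * y) - x * y * CCR.ann L h =
      (CCR.ann L h * x - x * CCR.ann L h) * y + x * (CCR.ann L h * y - y * CCR.ann L h) := by
      noncomm_ring
    rw [this]
    exact add_mem (mul_mem hx hy') (mul_mem hx' hy)

/-- Normal ordering. -/
theorem CCR.mem_creAlg_sup_annIdeal (A : CCR L) :
    A ∈ Subalgebra.toSubmodule (CCR.creAlg L) ⊔ CCR.annIdeal L := by
  set S := Subalgebra.toSubmodule (CCR.creAlg L) ⊔ CCR.annIdeal L with hS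
  -- The statement for `A` alone is not stable under products; stability of `S` under left
  -- multiplication is, and it is applied to `1 ∈ S`.
  suffices H : ∀ A : CCR L, ∀ B ∈ S, A * B ∈ S by
    simpa using H A 1 (Submodule.mem_sup_left (one_mem (CCR.creAlg L)))
  intro A
  induction A using CCR.induction with
  | halg r => intro B hB; rw [← Algebra.smul_def]; exact S.smul_mem _ hB
  | hann h =>
    intro B hB
    obtain ⟨C, hC, D, hD, rfl⟩ := Submodule.mem_sup.1 hB
    rw [mul_add]
    refine add_mem ?_ (Submodule.mem_sup_right (CCR.mul_mem_annIdeal _ hD))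
    -- Moving `a(h)` to the right of `C` leaves the commutator, again a polynomial in creators, and
    -- `C a(h)`, which lies in the left ideal.
    rw [← sub_add_cancel (CCR.ann L h * C) (C * CCR.ann L h)]
    exact add_mem (Submodule.mem_sup_left (CCR.ann_mul_sub_mem h hC))
      (Submodule.mem_sup_right (Submodule.subset_span ⟨C, h, rfl⟩))
  | hcre h =>
    intro B hB
    obtain ⟨C, hC, D, hD, rfl⟩ := Submodule.mem_sup.1 hB
    rw [mul_add]
    exact add_mem (Submodule.mem_sup_left
      ((CCR.creAlg L).mul_mem (Algebra.subset_adjoin ⟨h, rfl⟩) hC))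
      (Submodule.mem_sup_right (CCR.mul_mem_annIdeal _ hD))
  | hmul A B hA hB => intro D hD; rw [mul_assoc]; exact hA _ (hB _ hD)
  | hadd A B hA hB => intro D hD; rw [add_mul]; exact add_mem (hA _ hD) (hB _ hD)

/-- A normalized functional which vanishes on `A a(h)` and `a*(h) A` is unique. -/
theorem CCR.eq_of_vacuum {ω ω' : CCR L →ₗ[ℝ] ℝ} (h1 : ω 1 = ω' 1)
    (hann : ∀ A h, ω (A * CCR.ann L h) = 0) (hcre : ∀ A h, ω (CCR.cre L h * A) = 0)
    (hann' : ∀ A h, ω' (A * CCR.ann L h) = 0) (hcre' : ∀ A h, ω' (CCR.cre L h * A) = 0) :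
    ω = ω' := by
  ext A
  obtain ⟨C, hC, D, hD, rfl⟩ := Submodule.mem_sup.1 (CCR.mem_creAlg_sup_annIdeal A)
  rw [map_add, map_add]
  congr 1
  · have key : ∀ B ∈ CCR.creAlg L, ∀ C, ω C = ω' C → ω (B * C) = ω' (B * C) := by
      intro B hB
      induction hB using Algebra.adjoin_induction with
      | mem x hx => obtain ⟨k, rfl⟩ := hx; intro C _; rw [hcre, hcre']
      | algebraMap r => intro C h; rw [← Algebra.smul_def, map_smul, map_smul, h]
      | add x y _ _ hx hy => intro C h; rw [add_mul, map_add, map_add, hx _ h, hy _ h]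
      | mul x y _ _ hx hy => intro C h; rw [mul_assoc]; exact hx _ (hy _ h)
    simpa using key C hC 1 h1
  · change D ∈ LinearMap.eqLocus ω ω'
    refine (Submodule.span_le.2 ?_ : CCR.annIdeal L ≤ _) hD
    rintro _ ⟨B, h, rfl⟩
    exact (hann B h).trans (hann' B h).symm

/-- Cauchy–Schwarz: a Fock state vanishes on `A a(h)`. -/
theorem CCR.IsFockState.mul_ann {ω : CCR L →ₗ[ℝ] ℝ} (hω : CCR.IsFockState ω) (A : CCR L) (h : L) :
    ω (A * CCR.ann L h) = 0 := by
  have hstar : ω (CCR.cre L h * star A) = ω (A * CCR.ann L h) := by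
    rw [← hω.isState.map_star (A * CCR.ann L h), star_mul, CCR.star_ann]
  -- Expand `ω(X* X) ≥ 0` for `X = A* + t a(h)`. The `t²` term is `ω(a*(h) a(h)) = 0`, and
  -- hermiticity makes the two cross terms equal, so an affine function of `t` is nonnegative and
  -- its slope must vanish.
  have key : ∀ t : ℝ, 0 ≤ ω (A * star A) + t * (2 * ω (A * CCR.ann L h)) := by
    intro t
    have := hω.isState.nonneg (star A + t • CCR.ann L h)
    rw [star_add, star_star, CCR.star_smul, CCR.star_ann, add_mul, mul_add, mul_add] at this
    simp only [map_add, smul_mul_assoc, mul_smul_comm, map_smul, smul_eq_mul, hω.cre_ann,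
      hstar] at this
    linarith
  by_contra hne
  -- If the slope is not zero, the affine function takes the value `-1` here.
  have := key (-(ω (A * star A) + 1) / (2 * ω (A * CCR.ann L h)))
  rw [div_mul_cancel₀ _ (by simpa using hne)] at this
  linarith

theorem CCR.IsFockState.cre_mul {ω : CCR L →ₗ[ℝ] ℝ} (hω : CCR.IsFockState ω) (A : CCR L) (h : L) :
    ω (CCR.cre L h * A) = 0 := by
  rw [← hω.isState.map_star, star_mul, CCR.star_cre]
  exact hω.mul_ann _ _

theorem CCR.IsFockState.unique {ω ω' : CCR L →ₗ[ℝ] ℝ} (hω : CCR.IsFockState ω)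
    (hω' : CCR.IsFockState ω') : ω = ω' :=
  CCR.eq_of_vacuum (hω.isState.map_one.trans hω'.isState.map_one.symm) hω.mul_ann hω.cre_mul
    hω'.mul_ann hω'.cre_mul

/-! ### Vector states of representations -/

section VectorState

variable {D H : Type*} [AddCommGroup D] [Module ℝ D] [NormedAddCommGroup H]
  [InnerProductSpace ℝ H] (ρ : CCR L →ₐ[ℝ] Module.End ℝ D) (j : D →ₗ[ℝ] H)

/-- A representation in which `a(h)` and `a*(h)` are formally adjoint is a `*`-representation. -/
theorem inner_rep_star (hadj : ∀ k x y, ⟪j (ρ (CCR.cre L k) x), j y⟫ = ⟪j x, j (ρ (CCR.ann L k) y)⟫)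
    (A : CCR L) : ∀ x y, ⟪j (ρ A x), j y⟫ = ⟪j x, j (ρ (star A) y)⟫ := by
  induction A using CCR.induction with
  | halg r =>
    intro x y
    rw [CCR.star_algebraMap, AlgHom.commutes, Module.algebraMap_end_apply,
      Module.algebraMap_end_apply, map_smul, map_smul, real_inner_smul_left, real_inner_smul_right]
  | hann h => intro x y; rw [CCR.star_ann, real_inner_comm, ← hadj, real_inner_comm]
  | hcre h => intro x y; rw [CCR.star_cre, hadj]
  | hmul A B hA hB =>
    intro x y
    rw [star_mul, map_mul, map_mul, Module.End.mul_apply, Module.End.mul_apply, hA, hB]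
  | hadd A B hA hB =>
    intro x y
    rw [star_add, map_add, map_add, LinearMap.add_apply, LinearMap.add_apply, map_add, map_add,
      inner_add_left, inner_add_right, hA, hB]

variable (v : D)

/-- The functional `A ↦ ⟪v, ρ(A) v⟫`. -/
def vectorState : CCR L →ₗ[ℝ] ℝ :=
  innerₗ H (j v) ∘ₗ j ∘ₗ (LinearMap.applyₗ v) ∘ₗ ρ.toLinearMap

theorem vectorState_apply (A : CCR L) : vectorState ρ j v A = ⟪j v, j (ρ A v)⟫ := rfl

variable {v}

/-- Positivity is `ω(A* A) = ‖ρ(A) v‖²`; the two-point functions follow by commuting annihilators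
onto `v`. Applied both to the vacuum and to the constant function `1`. -/
theorem isFockState_vectorState
    (hadj : ∀ k x y, ⟪j (ρ (CCR.cre L k) x), j y⟫ = ⟪j x, j (ρ (CCR.ann L k) y)⟫)
    (hv : ‖j v‖ = 1) (hann : ∀ k, ρ (CCR.ann L k) v = 0) :
    CCR.IsFockState (vectorState ρ j v) where
  isState :=
    { map_one := by
        rw [vectorState_apply, map_one, Module.End.one_apply, real_inner_self_eq_norm_sq, hv,
          one_pow]
      nonneg := fun A => by
        rw [vectorState_apply, map_mul, Module.End.mul_apply, ← inner_rep_star ρ j hadj]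
        exact real_inner_self_nonneg
      map_star := fun A => by
        rw [vectorState_apply, vectorState_apply, ← inner_rep_star ρ j hadj, real_inner_comm] }
  ann_cre h k := by
    rw [vectorState_apply, CCR.ann_cre, map_add, AlgHom.commutes, map_mul, LinearMap.add_apply,
      Module.End.mul_apply, hann, map_zero, zero_add, Module.algebraMap_end_apply, map_smul,
      real_inner_smul_right, real_inner_self_eq_norm_sq, hv, one_pow, mul_one]
  cre_ann h := by
    rw [vectorState_apply, map_mul, Module.End.mul_apply, hann, map_zero, map_zero,
      inner_zero_right]

/-- The inner products of the vectors `ρ(A) v` are given by the vector state. -/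
theorem inner_rep_rep
    (hadj : ∀ k x y, ⟪j (ρ (CCR.cre L k) x), j y⟫ = ⟪j x, j (ρ (CCR.ann L k) y)⟫) (A B : CCR L) :
    ⟪j (ρ A v), j (ρ B v)⟫ = vectorState ρ j v (star A * B) := by
  rw [inner_rep_star ρ j hadj, vectorState_apply, map_mul, Module.End.mul_apply]

end VectorState

end CCRAlgebra

/-! ### The Fock representation: adjointness, cyclicity of the vacuum, exponential vectors -/

section FockSpace

variable {L : Type*} [NormedAddCommGroup L] [InnerProductSpace ℝ L]

theorem toFock_nPart (n : ℕ) (x : SymTensor L n) :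
    FockAlg.toFock (nPart n x) =
      lp.single 2 n (x : UniformSpace.Completion (SymTensor L n)) := by
  ext m
  change ((nPart n x m : SymTensor L m) : UniformSpace.Completion (SymTensor L m)) = _
  rw [lp.single_apply]
  obtain rfl | h := eq_or_ne m n
  · rw [Pi.single_eq_same]
    congr 1
    exact DirectSum.of_eq_same _ _
  · rw [Pi.single_eq_of_ne h, show nPart n x m = 0 from DirectSum.of_eq_of_ne _ _ _ h,
      UniformSpace.Completion.coe_zero]

theorem inner_toFock_nPart (n : ℕ) (x y : SymTensor L n) :
    ⟪FockAlg.toFock (nPart n x), FockAlg.toFock (nPart n y)⟫ = ⟪x, y⟫ := by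
  rw [toFock_nPart, toFock_nPart, lp.inner_single_left, lp.single_apply_self,
    UniformSpace.Completion.inner_coe]

theorem inner_toFock_nPart_of_ne {n m : ℕ} (h : n ≠ m) (x : SymTensor L n) (y : SymTensor L m) :
    ⟪FockAlg.toFock (nPart n x), FockAlg.toFock (nPart m y)⟫ = 0 := by
  rw [toFock_nPart, toFock_nPart, lp.inner_single_left, lp.single_apply_ne _ _ _ h,
    inner_zero_right]

theorem inner_creOp (k : L) (x y : FockAlg L) :
    ⟪FockAlg.toFock (creOp k x), FockAlg.toFock y⟫ =
      ⟪FockAlg.toFock x, FockAlg.toFock (annOp k y)⟫ := by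
  have : (innerₗ (Fock L)).compl₁₂ (FockAlg.toFock ∘ₗ creOp k) (FockAlg.toFock (L := L)) =
      (innerₗ (Fock L)).compl₁₂ (FockAlg.toFock (L := L)) (FockAlg.toFock ∘ₗ annOp k) := by
    refine FockAlg.hom_ext fun n x => FockAlg.hom_ext fun m y => ?_
    change ⟪FockAlg.toFock (creOp k (nPart n x)), FockAlg.toFock (nPart m y)⟫ =
      ⟪FockAlg.toFock (nPart n x), FockAlg.toFock (annOp k (nPart m y))⟫
    rw [creOp_nPart]
    match m, y with
    | 0, y =>
      rw [annOp_nPart_zero, map_zero, inner_zero_right, inner_toFock_nPart_of_ne n.succ_ne_zero]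
    | m + 1, y =>
      rw [annOp_nPart_succ]
      obtain rfl | h := eq_or_ne n m
      · rw [inner_toFock_nPart, inner_toFock_nPart, inner_creN_left]
      · rw [inner_toFock_nPart_of_ne h, inner_toFock_nPart_of_ne (by simpa using h)]
  exact LinearMap.congr_fun (LinearMap.congr_fun this x) y

theorem inner_fockRep_cre (k : L) (x y : FockAlg L) :
    ⟪FockAlg.toFock (fockRep (CCR.cre L k) x), FockAlg.toFock y⟫ =
      ⟪FockAlg.toFock x, FockAlg.toFock (fockRep (CCR.ann L k) y)⟫ := by
  rw [fockRep_cre, fockRep_ann, inner_creOp]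

theorem norm_toFock_vacuum : ‖FockAlg.toFock (vacuum L)‖ = 1 := by
  have h : ‖FockAlg.toFock (vacuum L)‖ ^ 2 = 1 := by
    rw [← real_inner_self_eq_norm_sq, vacuum, inner_toFock_nPart, real_inner_self_eq_norm_sq,
      norm_powTensor_sq, pow_zero]
  exact (pow_eq_one_iff_of_nonneg (norm_nonneg _) two_ne_zero).1 h

theorem fockRep_ann_vacuum (k : L) : fockRep (CCR.ann L k) (vacuum L) = 0 := by
  rw [fockRep_ann, vacuum, annOp_nPart_zero]

theorem fockState_eq : fockState L = vectorState fockRep FockAlg.toFock (vacuum L) := rfl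

variable (L) in
theorem isFockState_fockState : CCR.IsFockState (fockState L) :=
  isFockState_vectorState fockRep FockAlg.toFock inner_fockRep_cre norm_toFock_vacuum
    fockRep_ann_vacuum

theorem isFockState_iff (ω : CCR L →ₗ[ℝ] ℝ) : CCR.IsFockState ω ↔ ω = fockState L :=
  ⟨fun h => h.unique (isFockState_fockState L), fun h => h ▸ isFockState_fockState L⟩

theorem symmetrize_coe {n : ℕ} (x : SymTensor L n) : symmetrize n (x : TensorPow L n) = x :=
  ext_inner_right ℝ fun y => inner_symmetrize_left (x : TensorPow L n) y

/-- Symmetrizing before tensoring with `k` changes nothing: paired with a symmetric tensor, both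
symmetrizers move across, because contraction by `k` preserves symmetry. -/
theorem creN_symmetrize {n : ℕ} (k : L) (x : TensorPow L n) :
    creN n k (symmetrize n x) = √(n + 1 : ℝ) • symmetrize (n + 1) (tensorCons n k x) := by
  change √(n + 1 : ℝ) • symmetrize (n + 1) (tensorCons n k (symmetrize n x)) = _
  congr 1
  refine ext_inner_right ℝ fun y => ?_
  change ⟪(symmetrize (n + 1) (tensorCons n k (symmetrize n x)) : TensorPow L (n + 1)), y⟫ =
    ⟪(symmetrize (n + 1) (tensorCons n k x) : TensorPow L (n + 1)), y⟫
  rw [inner_symmetrize_left, inner_symmetrize_left, inner_tensorCons_left, inner_tensorCons_left]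
  exact inner_symmetrize_left x ⟨contract n k y, contract_mem k y.2⟩

theorem creN_powTensor (n : ℕ) (k : L) :
    creN n k (powTensor n k) = √(n + 1 : ℝ) • powTensor (n + 1) k := by
  conv_lhs => rw [← symmetrize_coe (powTensor n k)]
  rw [creN_symmetrize]
  congr 1
  rw [← symmetrize_coe (powTensor (n + 1) k)]
  congr 1
  change tensorCons n k (elemTensor L n fun _ => k) = elemTensor L (n + 1) fun _ => k
  rw [tensorCons_elem]
  congr 1
  ext i
  refine Fin.cases ?_ (fun j => ?_) i <;> simp

theorem powTensor_zero (k : L) : powTensor 0 k = powTensor 0 0 :=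
  Subtype.ext (congrArg (elemTensor L 0) (Subsingleton.elim _ _))

theorem fockRep_cre_pow_vacuum (k : L) (n : ℕ) :
    fockRep (CCR.cre L k ^ n) (vacuum L) = nPart n (√(n.factorial : ℝ) • powTensor n k) := by
  induction n with
  | zero => simp [vacuum, powTensor_zero k]
  | succ n ih =>
    rw [pow_succ', map_mul, Module.End.mul_apply, ih, fockRep_cre, creOp_nPart, map_smul,
      creN_powTensor, smul_smul, ← Real.sqrt_mul (by positivity), Nat.factorial_succ]
    push_cast
    rw [mul_comm]

variable (L) in
/-- The vectors `π_F(A)` vacuum. -/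
def cyclicSpan : Submodule ℝ (FockAlg L) :=
  LinearMap.range ((LinearMap.applyₗ (vacuum L)) ∘ₗ (fockRep (L := L)).toLinearMap)

theorem mem_cyclicSpan {x : FockAlg L} : x ∈ cyclicSpan L ↔ ∃ A, fockRep A (vacuum L) = x :=
  Iff.rfl

/-- Create the factors one at a time: `a*(h₀)` applied to the symmetrization of the remaining
factors gives the full symmetrization up to `√(n + 1)`. -/
theorem nPart_symmetrize_mem (n : ℕ) (h : Fin n → L) :
    nPart n (symmetrize n (elemTensor L n h)) ∈ cyclicSpan L := by
  induction n with
  | zero =>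
    refine mem_cyclicSpan.2 ⟨1, ?_⟩
    rw [map_one, Module.End.one_apply, vacuum, ← symmetrize_coe (powTensor 0 (0 : L))]
    congr 2
    exact congrArg (elemTensor L 0) (Subsingleton.elim _ _)
  | succ n ih =>
    obtain ⟨A, hA⟩ := mem_cyclicSpan.1 (ih (Fin.tail h))
    have hs : √((n : ℝ) + 1) ≠ 0 := by positivity
    refine mem_cyclicSpan.2 ⟨(√((n : ℝ) + 1))⁻¹ • (CCR.cre L (h 0) * A), ?_⟩
    rw [map_smul, map_mul, LinearMap.smul_apply, Module.End.mul_apply, hA, fockRep_cre,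
      creOp_nPart, creN_symmetrize, tensorCons_elem, Fin.cons_self_tail, map_smul,
      inv_smul_smul₀ hs]

/-- The vacuum is algebraically cyclic. -/
theorem exists_fockRep_vacuum_eq (x : FockAlg L) : ∃ A, fockRep A (vacuum L) = x := by
  -- Vanishing of the quotient map is a linear statement, so it may be tested on symmetrized
  -- elementary tensors, which exhaust the symmetric ones.
  have h0 : (cyclicSpan L).mkQ = 0 := by
    refine FockAlg.hom_ext fun n x => ?_
    have : (cyclicSpan L).mkQ ∘ₗ nPart n ∘ₗ symmetrize n = 0 :=
      TensorPow.hom_ext fun h => by simpa using nPart_symmetrize_mem n h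
    rw [← symmetrize_coe x]
    exact LinearMap.congr_fun this (x : TensorPow L n)
  rw [← mem_cyclicSpan, ← Submodule.ker_mkQ (cyclicSpan L), h0]
  exact LinearMap.mem_ker.2 rfl

/-- Two approximations: each component lies in a completion and is a limit of algebraic tensors, and
each vector is the sum of the series of its components. -/
theorem dense_range_toFock : Dense (LinearMap.range (FockAlg.toFock (L := L)) : Set (Fock L)) := by
  have hs : ∀ (n : ℕ) (x : UniformSpace.Completion (SymTensor L n)),
      lp.single 2 n x ∈ (LinearMap.range (FockAlg.toFock (L := L))).topologicalClosure := by
    intro n x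
    induction x using UniformSpace.Completion.induction_on with
    | hp =>
      exact (Submodule.isClosed_topologicalClosure _).preimage
        (lp.isometry_single (E := fun n => UniformSpace.Completion (SymTensor L n)) n).continuous
    | ih x =>
      rw [← toFock_nPart]
      exact Submodule.le_topologicalClosure _ ⟨_, rfl⟩
  intro F
  refine (Submodule.isClosed_topologicalClosure _).mem_of_tendsto
    (lp.hasSum_single ENNReal.ofNat_ne_top F) (Filter.Eventually.of_forall fun s => ?_)
  exact Submodule.sum_mem _ fun n _ => hs n _

/-- `e^k = ∑ₙ a*(k)ⁿ vacuum / n!`. -/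
theorem hasSum_expVec (k : L) :
    HasSum (fun n : ℕ => FockAlg.toFock (fockRep ((n.factorial : ℝ)⁻¹ • CCR.cre L k ^ n)
      (vacuum L))) (expVec k) := by
  have h := lp.hasSum_single (p := 2) ENNReal.ofNat_ne_top (expVec k)
  convert h using 2 with n
  rw [map_smul, LinearMap.smul_apply, fockRep_cre_pow_vacuum, ← map_smul, toFock_nPart, smul_smul]
  change _ = lp.single (E := fun n => UniformSpace.Completion (SymTensor L n)) 2 n
    (((√(n.factorial : ℝ))⁻¹ • powTensor n k : SymTensor L n) :
      UniformSpace.Completion (SymTensor L n))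
  congr 3
  -- The coefficients match because `√(n!) / n! = 1 / √(n!)`.
  have := Real.mul_self_sqrt (show (0 : ℝ) ≤ n.factorial by positivity)
  have h0 : √(n.factorial : ℝ) ≠ 0 := by positivity
  rw [inv_mul_eq_iff_eq_mul₀ (by positivity), eq_mul_inv_iff_mul_eq₀ h0, this]

end FockSpace

/-! ### Random variables with all moments, and differentiation under the expectation -/

section Moments

variable {Ω : Type*} [MeasurableSpace Ω] {P : Measure Ω}

/-- All moments of `f` are finite. -/
def HasAllMoments (f : Ω → ℝ) (P : Measure Ω) : Prop :=
  ∀ q : ENNReal, q ≠ ⊤ → MemLp f q P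

namespace HasAllMoments

variable {f g : Ω → ℝ}

theorem add (hf : HasAllMoments f P) (hg : HasAllMoments g P) :
    HasAllMoments (fun ω => f ω + g ω) P :=
  fun q hq => (hf q hq).add (hg q hq)

theorem mul (hf : HasAllMoments f P) (hg : HasAllMoments g P) :
    HasAllMoments (fun ω => f ω * g ω) P := fun q hq => by
  have hq2 : 2 * q ≠ ⊤ := ENNReal.mul_ne_top ENNReal.ofNat_ne_top hq
  have : ENNReal.HolderTriple (2 * q) (2 * q) q := ⟨by
    rw [ENNReal.mul_inv (.inl two_ne_zero) (.inl ENNReal.ofNat_ne_top), ← add_mul,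
      ENNReal.inv_two_add_inv_two, one_mul]⟩
  exact (hg _ hq2).mul' (hf _ hq2)

theorem const [IsFiniteMeasure P] (c : ℝ) : HasAllMoments (fun _ : Ω => c) P :=
  fun _ _ => memLp_const c

theorem integrable (hf : HasAllMoments f P) : Integrable f P :=
  memLp_one_iff_integrable.1 (hf 1 ENNReal.one_ne_top)

theorem norm (hf : HasAllMoments f P) : HasAllMoments (fun ω => ‖f ω‖) P :=
  fun q hq => (hf q hq).norm

theorem exp (hf : AEMeasurable f P) (h : ∀ t : ℝ, Integrable (fun ω => Real.exp (t * f ω)) P) :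
    HasAllMoments (fun ω => Real.exp (f ω)) P := fun q hq => by
  have hm : AEStronglyMeasurable (fun ω => Real.exp (f ω)) P :=
    hf.exp.aestronglyMeasurable
  obtain rfl | h0 := eq_or_ne q 0
  · exact memLp_zero_iff_aestronglyMeasurable.2 hm
  · rw [← integrable_norm_rpow_iff hm h0 hq]
    refine (h q.toReal).congr (Filter.Eventually.of_forall fun ω => ?_)
    simp only [Real.norm_eq_abs, Real.abs_exp, ← Real.exp_mul, mul_comm]

end HasAllMoments

/-- Differentiation of `t ↦ E(G exp(t Y))` at `0`. -/
theorem hasDerivAt_integral_mul_exp {G Y : Ω → ℝ} (hG : HasAllMoments G P)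
    (hY : HasAllMoments Y P) (hp : HasAllMoments (fun ω => Real.exp (Y ω)) P)
    (hn : HasAllMoments (fun ω => Real.exp (-Y ω)) P) :
    HasDerivAt (fun t : ℝ => ∫ ω, G ω * Real.exp (t * Y ω) ∂P) (∫ ω, G ω * Y ω ∂P) 0 := by
  have hGm := (hG.integrable).aestronglyMeasurable
  have hYm := (hY.integrable).aestronglyMeasurable
  have hd := hasDerivAt_integral_of_dominated_loc_of_deriv_le (μ := P) (𝕜 := ℝ) (x₀ := (0 : ℝ))
    (F := fun t ω => G ω * Real.exp (t * Y ω))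
    (F' := fun t ω => G ω * (Real.exp (t * Y ω) * Y ω))
    -- For `|t| < 1` one has `exp(tY) ≤ exp|Y| ≤ exp(Y) + exp(-Y)`, uniformly in `t`.
    (bound := fun ω => ‖G ω‖ * ((Real.exp (Y ω) + Real.exp (-Y ω)) * ‖Y ω‖))
    (Metric.ball_mem_nhds 0 one_pos) ?_ ?_ ?_ ?_ ?_ ?_
  · simpa using hd.2
  · exact Filter.Eventually.of_forall fun t =>
      hGm.mul (Real.continuous_exp.comp_aestronglyMeasurable (hYm.const_mul t))
  · simpa using hG.integrable
  · exact hGm.mul ((Real.continuous_exp.comp_aestronglyMeasurable (hYm.const_mul _)).mul hYm)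
  · refine Filter.Eventually.of_forall fun ω t ht => ?_
    rw [norm_mul, norm_mul, Real.norm_eq_abs (Real.exp _), Real.abs_exp]
    have ht' : |t| < 1 := by simpa using ht
    gcongr
    have h1 : t * Y ω ≤ |Y ω| := by
      calc t * Y ω ≤ |t * Y ω| := le_abs_self _
        _ = |t| * |Y ω| := abs_mul _ _
        _ ≤ 1 * |Y ω| := by gcongr
        _ = |Y ω| := one_mul _
    refine (Real.exp_le_exp.2 h1).trans ?_
    rcases abs_cases (Y ω) with h | h <;> rw [h.1]
    · exact le_add_of_nonneg_right (Real.exp_pos _).le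
    · exact le_add_of_nonneg_left (Real.exp_pos _).le
  · exact (hG.norm.mul ((hp.add hn).mul hY.norm)).integrable
  · refine Filter.Eventually.of_forall fun ω t _ => ?_
    have : HasDerivAt (fun t : ℝ => t * Y ω) (Y ω) t := by
      simpa using (hasDerivAt_id t).mul_const (Y ω)
    exact this.exp.const_mul (G ω)

end Moments

/-! ### Exponential moments and Gaussian integration by parts -/

section Wick

variable {L : Type*} [NormedAddCommGroup L] [InnerProductSpace ℝ L]
  {Ω : Type*} [MeasurableSpace Ω] {P : Measure Ω} {Φ : L →ₗ[ℝ] Lp ℝ 2 P}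

theorem field_add (Φ : L →ₗ[ℝ] Lp ℝ 2 P) (h k : L) : Φ (h + k) =ᵐ[P] fun ω => Φ h ω + Φ k ω := by
  rw [map_add]; exact Lp.coeFn_add _ _

theorem field_smul (Φ : L →ₗ[ℝ] Lp ℝ 2 P) (c : ℝ) (h : L) : Φ (c • h) =ᵐ[P] fun ω => c * Φ h ω := by
  rw [map_smul]; exact Lp.coeFn_smul _ _

theorem field_add_smul (Φ : L →ₗ[ℝ] Lp ℝ 2 P) (h k : L) (t : ℝ) :
    Φ (h + t • k) =ᵐ[P] fun ω => Φ h ω + t * Φ k ω := by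
  filter_upwards [field_add Φ h (t • k), field_smul Φ t k] with ω h1 h2
  rw [h1, h2]

namespace IsGaussianField

theorem hasAllMoments (hΦ : IsGaussianField Φ) (h : L) : HasAllMoments (Φ h) P :=
  fun _ hq => (hΦ.gaussian.hasGaussianLaw_eval h).memLp hq

theorem map_eq [IsProbabilityMeasure P] (hΦ : IsGaussianField Φ) (h : L) :
    P.map (Φ h) = gaussianReal 0 (‖h‖ ^ 2).toNNReal := by
  have hm : AEMeasurable (Φ h) P := (Lp.aestronglyMeasurable _).aemeasurable
  have hv : Var[Φ h; P] = ‖h‖ ^ 2 := by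
    rw [variance_of_integral_eq_zero hm (hΦ.mean h), ← real_inner_self_eq_norm_sq, ← hΦ.cov]
    simp_rw [sq]
  have := (hΦ.gaussian.hasGaussianLaw_eval h).map_eq_gaussianReal
  rwa [hΦ.mean h, hv] at this

theorem integral_exp [IsProbabilityMeasure P] (hΦ : IsGaussianField Φ) (h : L) :
    ∫ ω, Real.exp (Φ h ω) ∂P = Real.exp (‖h‖ ^ 2 / 2) := by
  have := mgf_gaussianReal (hΦ.map_eq h) 1
  simpa [mgf, Real.coe_toNNReal _ (sq_nonneg ‖h‖)] using this

theorem integrable_exp_mul [IsProbabilityMeasure P] (hΦ : IsGaussianField Φ) (h : L) (t : ℝ) :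
    Integrable (fun ω => Real.exp (t * Φ h ω)) P := by
  rw [← mgf_pos_iff, mgf_gaussianReal (hΦ.map_eq h)]
  exact Real.exp_pos _

theorem hasAllMoments_exp [IsProbabilityMeasure P] (hΦ : IsGaussianField Φ) (h : L) :
    HasAllMoments (fun ω => Real.exp (Φ h ω)) P :=
  HasAllMoments.exp (Lp.aestronglyMeasurable _).aemeasurable (hΦ.integrable_exp_mul h)

theorem hasAllMoments_exp_neg [IsProbabilityMeasure P] (hΦ : IsGaussianField Φ) (h : L) :
    HasAllMoments (fun ω => Real.exp (-Φ h ω)) P :=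
  HasAllMoments.exp (Lp.aestronglyMeasurable _).aemeasurable.neg fun t => by
    simpa using hΦ.integrable_exp_mul h (-t)

end IsGaussianField

/-- The random variable given by a polynomial in the variables `X_h`, `h ∈ L`. -/
def fieldEval (Φ : L →ₗ[ℝ] Lp ℝ 2 P) (p : MvPolynomial L ℝ) (ω : Ω) : ℝ :=
  MvPolynomial.eval (fun h => Φ h ω) p

theorem IsGaussianField.hasAllMoments_fieldEval [IsProbabilityMeasure P] (hΦ : IsGaussianField Φ)
    (p : MvPolynomial L ℝ) : HasAllMoments (fieldEval Φ p) P := by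
  induction p using MvPolynomial.induction_on with
  | C c =>
    convert HasAllMoments.const (P := P) c using 2 with ω
    simp [fieldEval]
  | add p q hp hq =>
    convert hp.add hq using 2 with ω
    simp [fieldEval]
  | mul_X p h hp =>
    convert hp.mul (hΦ.hasAllMoments h) using 2 with ω
    simp [fieldEval]

/-- The derivation of the polynomial algebra with `X_l ↦ ⟪k, l⟫`. -/
def dirDeriv (k : L) : Derivation ℝ (MvPolynomial L ℝ) (MvPolynomial L ℝ) :=
  MvPolynomial.mkDerivation ℝ fun l => MvPolynomial.C ⟪k, l⟫

theorem dirDeriv_X (k l : L) : dirDeriv k (MvPolynomial.X l) = MvPolynomial.C ⟪k, l⟫ :=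
  MvPolynomial.mkDerivation_X _ _ _

/-- `E(p(Φ) exp(Φ(k)))`. -/
def expMoment (Φ : L →ₗ[ℝ] Lp ℝ 2 P) (p : MvPolynomial L ℝ) (k : L) : ℝ :=
  ∫ ω, fieldEval Φ p ω * Real.exp (Φ k ω) ∂P

theorem expMoment_C_mul (c : ℝ) (p : MvPolynomial L ℝ) (k : L) :
    expMoment Φ (MvPolynomial.C c * p) k = c * expMoment Φ p k := by
  rw [expMoment, expMoment, ← integral_const_mul]
  simp [fieldEval, mul_assoc]

section

variable [IsProbabilityMeasure P]

theorem IsGaussianField.expMoment_add (hΦ : IsGaussianField Φ) (p q : MvPolynomial L ℝ) (k : L) :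
    expMoment Φ (p + q) k = expMoment Φ p k + expMoment Φ q k := by
  rw [expMoment, expMoment, expMoment, ← integral_add
    ((hΦ.hasAllMoments_fieldEval p).mul (hΦ.hasAllMoments_exp k)).integrable
    ((hΦ.hasAllMoments_fieldEval q).mul (hΦ.hasAllMoments_exp k)).integrable]
  simp [fieldEval, add_mul]

theorem IsGaussianField.expMoment_one (hΦ : IsGaussianField Φ) (k : L) :
    expMoment Φ 1 k = Real.exp (‖k‖ ^ 2 / 2) := by
  simp [expMoment, fieldEval, hΦ.integral_exp]

/-- By linearity of the field, shifting `k` by `t l` inserts `exp(t Φ(l))`, so multiplication by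
`X_l` is differentiation in `k`. This drives the induction for integration by parts. -/
theorem IsGaussianField.hasDerivAt_expMoment (hΦ : IsGaussianField Φ) (p : MvPolynomial L ℝ)
    (k l : L) :
    HasDerivAt (fun t : ℝ => expMoment Φ p (k + t • l))
      (expMoment Φ (p * MvPolynomial.X l) k) 0 := by
  have h := hasDerivAt_integral_mul_exp
    ((hΦ.hasAllMoments_fieldEval p).mul (hΦ.hasAllMoments_exp k)) (hΦ.hasAllMoments l)
    (hΦ.hasAllMoments_exp l) (hΦ.hasAllMoments_exp_neg l)
  convert h using 1
  · funext t
    refine integral_congr_ae ?_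
    filter_upwards [field_add_smul Φ k l t] with ω hω
    rw [hω, Real.exp_add, mul_assoc]
  · refine integral_congr_ae (Filter.Eventually.of_forall fun ω => ?_)
    simp only [fieldEval, map_mul, MvPolynomial.eval_X]
    ring

/-- Gaussian integration by parts. -/
theorem IsGaussianField.expMoment_X_mul (hΦ : IsGaussianField Φ) (h : L) (p : MvPolynomial L ℝ) :
    ∀ k, expMoment Φ (MvPolynomial.X h * p) k =
      ⟪h, k⟫ * expMoment Φ p k + expMoment Φ (dirDeriv h p) k := by
  -- The induction keeps `k` universally quantified, since the step for `p * X l` differentiates the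
  -- identity for `p` along `k + t l`.
  induction p using MvPolynomial.induction_on with
  | C c =>
    intro k
    -- For constants, the identity is the derivative of `exp(‖k‖² / 2)` in direction `h`, computed
    -- in two ways.
    have h1 := hΦ.hasDerivAt_expMoment 1 k h
    simp only [hΦ.expMoment_one, one_mul] at h1
    have h2 : HasDerivAt (fun t : ℝ => Real.exp (‖k + t • h‖ ^ 2 / 2))
        (⟪h, k⟫ * Real.exp (‖k‖ ^ 2 / 2)) 0 := by
      have h3 : HasDerivAt (fun t : ℝ => k + t • h) h 0 := by
        simpa using ((hasDerivAt_id (0 : ℝ)).smul_const h).const_add k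
      have := (h3.norm_sq.div_const 2).exp
      convert this using 1
      simp [real_inner_comm]
      ring
    have hC : expMoment Φ (dirDeriv h (MvPolynomial.C c)) k = 0 := by
      rw [← MvPolynomial.algebraMap_eq, Derivation.map_algebraMap]
      simp [expMoment, fieldEval]
    rw [hC, add_zero, mul_comm (MvPolynomial.X h), expMoment_C_mul, h1.unique h2,
      ← mul_one (MvPolynomial.C c), expMoment_C_mul, hΦ.expMoment_one]
    ring
  | add p q hp hq =>
    intro k
    rw [mul_add, map_add, hΦ.expMoment_add, hΦ.expMoment_add, hΦ.expMoment_add, hp, hq]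
    ring
  | mul_X p l hp =>
    intro k
    have h1 := hΦ.hasDerivAt_expMoment (MvPolynomial.X h * p) k l
    simp only [hp] at h1
    have h3 : HasDerivAt (fun t : ℝ => ⟪h, k + t • l⟫) ⟪h, l⟫ 0 := by
      have : (fun t : ℝ => ⟪h, k + t • l⟫) = fun t : ℝ => ⟪h, k⟫ + t * ⟪h, l⟫ := by
        funext t; rw [inner_add_right, real_inner_smul_right]
      rw [this]
      simpa using ((hasDerivAt_id (0 : ℝ)).mul_const ⟪h, l⟫).const_add ⟪h, k⟫
    -- Differentiating the factor `⟪h, k⟫` produces `⟪h, l⟫ p`, which is exactly the new Leibniz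
    -- term of `∂_h (p X_l)`.
    have h2 := (h3.mul (hΦ.hasDerivAt_expMoment p k l)).add
      (hΦ.hasDerivAt_expMoment (dirDeriv h p) k l)
    rw [← mul_assoc, h1.unique h2, Derivation.leibniz, hΦ.expMoment_add, dirDeriv_X, smul_eq_mul,
      smul_eq_mul, mul_comm p (MvPolynomial.C _), expMoment_C_mul, zero_smul, add_zero,
      mul_comm (dirDeriv h p)]
    ring

end

end Wick

/-! ### The commutation relations for `∂_k` and `X_k - ∂_k` on polynomials -/

section GaussianRep

variable {L : Type*} [NormedAddCommGroup L] [InnerProductSpace ℝ L]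
  {Ω : Type*} [MeasurableSpace Ω] {P : Measure Ω} {Φ : L →ₗ[ℝ] Lp ℝ 2 P}
  [IsProbabilityMeasure P]

theorem dirDeriv_add (k l : L) (p : MvPolynomial L ℝ) :
    dirDeriv (k + l) p = dirDeriv k p + dirDeriv l p := by
  have : dirDeriv (k + l) = dirDeriv k + dirDeriv l :=
    MvPolynomial.derivation_ext fun h => by
      rw [Derivation.add_apply, dirDeriv_X, dirDeriv_X, dirDeriv_X, inner_add_left, map_add]
  rw [this, Derivation.add_apply]

theorem dirDeriv_smul (c : ℝ) (k : L) (p : MvPolynomial L ℝ) :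
    dirDeriv (c • k) p = c • dirDeriv k p := by
  have : dirDeriv (c • k) = c • dirDeriv k :=
    MvPolynomial.derivation_ext fun h => by
      rw [Derivation.smul_apply, dirDeriv_X, dirDeriv_X, real_inner_smul_left,
        MvPolynomial.smul_eq_C_mul, map_mul]
  rw [this, Derivation.smul_apply]

/-- The commutator of two derivations is a derivation, and here it kills every variable because each
first derivative of a variable is constant. -/
theorem dirDeriv_comm (k l : L) (p : MvPolynomial L ℝ) :
    dirDeriv k (dirDeriv l p) = dirDeriv l (dirDeriv k p) := by
  have : ⁅dirDeriv k, dirDeriv l⁆ = 0 := MvPolynomial.derivation_ext fun h => by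
    rw [Derivation.commutator_apply, dirDeriv_X, dirDeriv_X, ← MvPolynomial.algebraMap_eq,
      Derivation.map_algebraMap, Derivation.map_algebraMap, sub_zero, Derivation.zero_apply]
  rw [← sub_eq_zero, ← Derivation.commutator_apply, this, Derivation.zero_apply]

theorem dirDeriv_X_mul (k l : L) (p : MvPolynomial L ℝ) :
    dirDeriv k (MvPolynomial.X l * p) = MvPolynomial.X l * dirDeriv k p + ⟪k, l⟫ • p := by
  rw [Derivation.leibniz, dirDeriv_X, smul_eq_mul, smul_eq_mul, mul_comm p,
    MvPolynomial.smul_eq_C_mul]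

/-- The creation operator `X_k - ∂_k` on polynomials. -/
def polyCre (k : L) : MvPolynomial L ℝ →ₗ[ℝ] MvPolynomial L ℝ :=
  LinearMap.mulLeft ℝ (MvPolynomial.X k) - (dirDeriv k).toLinearMap

theorem polyCre_apply (k : L) (p : MvPolynomial L ℝ) :
    polyCre k p = MvPolynomial.X k * p - dirDeriv k p := rfl

theorem polyCre_comm (h k : L) (p : MvPolynomial L ℝ) :
    polyCre h (polyCre k p) = polyCre k (polyCre h p) := by
  simp only [polyCre_apply, map_sub, dirDeriv_X_mul, dirDeriv_comm h k p,
    real_inner_comm h k, mul_left_comm (MvPolynomial.X h)]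
  abel

theorem dirDeriv_polyCre (h k : L) (p : MvPolynomial L ℝ) :
    dirDeriv h (polyCre k p) = polyCre k (dirDeriv h p) + ⟪h, k⟫ • p := by
  simp only [polyCre_apply, map_sub, dirDeriv_X_mul, dirDeriv_comm h k p]
  abel

namespace IsGaussianField

/-- The class in `L²` of a polynomial in the field. -/
def ev (hΦ : IsGaussianField Φ) : MvPolynomial L ℝ →ₗ[ℝ] Lp ℝ 2 P where
  toFun p := (hΦ.hasAllMoments_fieldEval p 2 ENNReal.ofNat_ne_top).toLp
  map_add' p q := by
    rw [← MemLp.toLp_add]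
    exact MemLp.toLp_congr _ _ (Filter.Eventually.of_forall fun ω => by simp [fieldEval])
  map_smul' c p := by
    rw [RingHom.id_apply, ← MemLp.toLp_const_smul]
    exact MemLp.toLp_congr _ _ (Filter.Eventually.of_forall fun ω => by simp [fieldEval])

theorem coeFn_ev (hΦ : IsGaussianField Φ) (p : MvPolynomial L ℝ) : hΦ.ev p =ᵐ[P] fieldEval Φ p :=
  MemLp.coeFn_toLp (hΦ.hasAllMoments_fieldEval p 2 ENNReal.ofNat_ne_top)

/-- The normalized exponential `exp(Φ(k) - ‖k‖² / 2)`. -/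
def expField (hΦ : IsGaussianField Φ) (k : L) : Lp ℝ 2 P :=
  MemLp.toLp (fun ω => Real.exp (Φ k ω - 1 / 2 * ‖k‖ ^ 2)) (by
    simp_rw [Real.exp_sub, div_eq_mul_inv]
    exact (hΦ.hasAllMoments_exp k 2 ENNReal.ofNat_ne_top).mul_const _)

theorem coeFn_expField (hΦ : IsGaussianField Φ) (k : L) :
    hΦ.expField k =ᵐ[P] fun ω => Real.exp (Φ k ω - 1 / 2 * ‖k‖ ^ 2) :=
  MemLp.coeFn_toLp _

theorem inner_ev_ev (hΦ : IsGaussianField Φ) (p q : MvPolynomial L ℝ) :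
    ⟪hΦ.ev p, hΦ.ev q⟫ = expMoment Φ (p * q) 0 := by
  rw [L2.inner_def, expMoment]
  refine integral_congr_ae ?_
  filter_upwards [hΦ.coeFn_ev p, hΦ.coeFn_ev q] with ω h1 h2
  simp [h1, h2, fieldEval, mul_comm]

theorem inner_ev_expField (hΦ : IsGaussianField Φ) (p : MvPolynomial L ℝ) (k : L) :
    ⟪hΦ.ev p, hΦ.expField k⟫ = Real.exp (-(1 / 2 * ‖k‖ ^ 2)) * expMoment Φ p k := by
  rw [L2.inner_def, expMoment, ← integral_const_mul]
  refine integral_congr_ae ?_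
  filter_upwards [hΦ.coeFn_ev p, hΦ.coeFn_expField k] with ω h1 h2
  simp only [h1, h2, sub_eq_add_neg, Real.exp_add, RCLike.inner_apply, conj_trivial]
  ring

theorem norm_expField_sq (hΦ : IsGaussianField Φ) (k : L) :
    ‖hΦ.expField k‖ ^ 2 = Real.exp (‖k‖ ^ 2) := by
  rw [← real_inner_self_eq_norm_sq, L2.inner_def]
  have : ∫ ω, ⟪hΦ.expField k ω, hΦ.expField k ω⟫ ∂P =
      ∫ ω, Real.exp (-‖k‖ ^ 2) * Real.exp (Φ ((2 : ℝ) • k) ω) ∂P := by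
    refine integral_congr_ae ?_
    filter_upwards [hΦ.coeFn_expField k, field_smul Φ 2 k] with ω h1 h2
    rw [h1, h2, RCLike.inner_apply, conj_trivial, ← Real.exp_add, ← Real.exp_add]
    congr 1
    ring
  rw [this, integral_const_mul, hΦ.integral_exp, ← Real.exp_add, norm_smul]
  congr 1
  rw [Real.norm_ofNat]
  ring

/-- In weak form, the exponential is an eigenvector of the annihilation operator with eigenvalue
`⟪h, k⟫`. Integration by parts leaves this term after the derivative of `p` cancels. -/
theorem inner_polyCre_expField (hΦ : IsGaussianField Φ) (h : L) (p : MvPolynomial L ℝ) (k : L) :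
    ⟪hΦ.ev (polyCre h p), hΦ.expField k⟫ = ⟪h, k⟫ * ⟪hΦ.ev p, hΦ.expField k⟫ := by
  rw [polyCre_apply, map_sub, inner_sub_left, inner_ev_expField, inner_ev_expField,
    inner_ev_expField, hΦ.expMoment_X_mul]
  ring

/-- `X_k - ∂_k` and `∂_k` are formally adjoint. -/
theorem inner_polyCre (hΦ : IsGaussianField Φ) (k : L) (p q : MvPolynomial L ℝ) :
    ⟪hΦ.ev (polyCre k p), hΦ.ev q⟫ = ⟪hΦ.ev p, hΦ.ev (dirDeriv k q)⟫ := by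
  rw [polyCre_apply, map_sub, inner_sub_left, inner_ev_ev, inner_ev_ev, inner_ev_ev, mul_assoc,
    hΦ.expMoment_X_mul, Derivation.leibniz, hΦ.expMoment_add, smul_eq_mul, smul_eq_mul,
    inner_zero_right, mul_comm q]
  ring

/-- By adjointness `‖∂_k p‖² = ⟪(X_k - ∂_k) ∂_k p, p⟫`, which vanishes with `p`. Every
well-definedness claim about derivatives of polynomial fields reduces to this. -/
theorem ev_dirDeriv_eq_zero (hΦ : IsGaussianField Φ) (k : L) {p : MvPolynomial L ℝ}
    (hp : hΦ.ev p = 0) : hΦ.ev (dirDeriv k p) = 0 := by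
  rw [← inner_self_eq_zero (𝕜 := ℝ), ← hΦ.inner_polyCre, hp, inner_zero_right]

theorem ev_X_mul (hΦ : IsGaussianField Φ) (k : L) (p : MvPolynomial L ℝ) :
    hΦ.ev (MvPolynomial.X k * p) =ᵐ[P] fun ω => Φ k ω * hΦ.ev p ω := by
  filter_upwards [hΦ.coeFn_ev p, hΦ.coeFn_ev (MvPolynomial.X k * p)] with ω h1 h2
  simp [h1, h2, fieldEval]

theorem ev_X_mul_eq_zero (hΦ : IsGaussianField Φ) (k : L) {p : MvPolynomial L ℝ}
    (hp : hΦ.ev p = 0) : hΦ.ev (MvPolynomial.X k * p) = 0 := by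
  refine Lp.ext ?_
  have h0 : (hΦ.ev p : Ω → ℝ) =ᵐ[P] 0 := by rw [hp]; exact Lp.coeFn_zero _ _ _
  filter_upwards [hΦ.ev_X_mul k p, h0, Lp.coeFn_zero ℝ 2 P] with ω h1 h2 h3
  rw [h1, h2, h3]
  simp

/-- In the polynomial ring the variables `X_k` are independent and not additive in `k`; the relation
holds only after evaluation. Hence the creation operators become linear in `k` only on the quotient
`PolyField`. -/
theorem ev_X_add_mul (hΦ : IsGaussianField Φ) (k l : L) (p : MvPolynomial L ℝ) :
    hΦ.ev (MvPolynomial.X (k + l) * p) =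
      hΦ.ev (MvPolynomial.X k * p) + hΦ.ev (MvPolynomial.X l * p) := by
  refine Lp.ext ?_
  filter_upwards [hΦ.ev_X_mul k p, hΦ.ev_X_mul l p, hΦ.ev_X_mul (k + l) p, field_add Φ k l,
    Lp.coeFn_add (hΦ.ev (MvPolynomial.X k * p)) (hΦ.ev (MvPolynomial.X l * p))]
    with ω h1 h2 h3 h4 h5
  rw [h3, h5, Pi.add_apply, h1, h2, h4]
  ring

theorem ev_X_smul_mul (hΦ : IsGaussianField Φ) (c : ℝ) (k : L) (p : MvPolynomial L ℝ) :
    hΦ.ev (MvPolynomial.X (c • k) * p) = c • hΦ.ev (MvPolynomial.X k * p) := by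
  refine Lp.ext ?_
  filter_upwards [hΦ.ev_X_mul k p, hΦ.ev_X_mul (c • k) p, field_smul Φ c k,
    Lp.coeFn_smul c (hΦ.ev (MvPolynomial.X k * p))] with ω h1 h2 h3 h4
  rw [h2, h4, Pi.smul_apply, h1, h3, smul_eq_mul]
  ring

/-! ### The representation on polynomial fields -/

/-- The polynomials in the field, as a quotient of the polynomial algebra. -/
def PolyField (hΦ : IsGaussianField Φ) : Type _ := MvPolynomial L ℝ ⧸ LinearMap.ker hΦ.ev

instance (hΦ : IsGaussianField Φ) : AddCommGroup hΦ.PolyField :=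
  inferInstanceAs (AddCommGroup (MvPolynomial L ℝ ⧸ LinearMap.ker hΦ.ev))

instance (hΦ : IsGaussianField Φ) : Module ℝ hΦ.PolyField :=
  inferInstanceAs (Module ℝ (MvPolynomial L ℝ ⧸ LinearMap.ker hΦ.ev))

/-- The inclusion of the polynomials in the field into `L²`. -/
def evQ (hΦ : IsGaussianField Φ) : hΦ.PolyField →ₗ[ℝ] Lp ℝ 2 P :=
  (LinearMap.ker hΦ.ev).liftQ hΦ.ev le_rfl

/-- The class of a polynomial. -/
def cls (hΦ : IsGaussianField Φ) : MvPolynomial L ℝ →ₗ[ℝ] hΦ.PolyField :=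
  (LinearMap.ker hΦ.ev).mkQ

theorem evQ_cls (hΦ : IsGaussianField Φ) (p : MvPolynomial L ℝ) : hΦ.evQ (hΦ.cls p) = hΦ.ev p :=
  rfl

theorem cls_surjective (hΦ : IsGaussianField Φ) : Function.Surjective hΦ.cls :=
  Submodule.mkQ_surjective _

theorem evQ_injective (hΦ : IsGaussianField Φ) : Function.Injective hΦ.evQ :=
  LinearMap.ker_eq_bot.1 (Submodule.ker_liftQ_eq_bot' _ _ rfl)

theorem hom_ext_cls (hΦ : IsGaussianField Φ) {E : Type*} [AddCommGroup E] [Module ℝ E]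
    {f g : hΦ.PolyField →ₗ[ℝ] E} (H : ∀ p, f (hΦ.cls p) = g (hΦ.cls p)) : f = g :=
  LinearMap.ext fun x => by obtain ⟨p, rfl⟩ := hΦ.cls_surjective x; exact H p

/-- The operator on the polynomials in the field induced by an operator on polynomials. -/
def descend (hΦ : IsGaussianField Φ) (f : MvPolynomial L ℝ →ₗ[ℝ] MvPolynomial L ℝ)
    (hf : ∀ p, hΦ.ev p = 0 → hΦ.ev (f p) = 0) : Module.End ℝ hΦ.PolyField :=
  Submodule.mapQ (LinearMap.ker hΦ.ev) (LinearMap.ker hΦ.ev) f hf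

theorem descend_cls (hΦ : IsGaussianField Φ) (f : MvPolynomial L ℝ →ₗ[ℝ] MvPolynomial L ℝ)
    (hf : ∀ p, hΦ.ev p = 0 → hΦ.ev (f p) = 0) (p : MvPolynomial L ℝ) :
    hΦ.descend f hf (hΦ.cls p) = hΦ.cls (f p) := rfl

/-- The operators `∂_k` on the polynomials in the field. -/
def annQ (hΦ : IsGaussianField Φ) : L →ₗ[ℝ] Module.End ℝ hΦ.PolyField where
  toFun k := hΦ.descend (dirDeriv k).toLinearMap fun _ hp => hΦ.ev_dirDeriv_eq_zero k hp
  map_add' k l := hΦ.hom_ext_cls fun p => by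
    rw [LinearMap.add_apply, descend_cls, descend_cls, descend_cls, ← map_add]
    exact congrArg hΦ.cls (dirDeriv_add k l p)
  map_smul' c k := hΦ.hom_ext_cls fun p => by
    rw [RingHom.id_apply, LinearMap.smul_apply, descend_cls, descend_cls, ← map_smul]
    exact congrArg hΦ.cls (dirDeriv_smul c k p)

theorem annQ_cls (hΦ : IsGaussianField Φ) (k : L) (p : MvPolynomial L ℝ) :
    hΦ.annQ k (hΦ.cls p) = hΦ.cls (dirDeriv k p) :=
  hΦ.descend_cls _ (fun _ hp => hΦ.ev_dirDeriv_eq_zero k hp) p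

theorem ev_polyCre_eq_zero (hΦ : IsGaussianField Φ) (k : L) {p : MvPolynomial L ℝ}
    (hp : hΦ.ev p = 0) : hΦ.ev (polyCre k p) = 0 := by
  rw [polyCre_apply, map_sub, hΦ.ev_X_mul_eq_zero k hp, hΦ.ev_dirDeriv_eq_zero k hp, sub_zero]

/-- The operators `Φ(k) - ∂_k` on the polynomials in the field. -/
def creQ (hΦ : IsGaussianField Φ) : L →ₗ[ℝ] Module.End ℝ hΦ.PolyField where
  toFun k := hΦ.descend (polyCre k) fun _ hp => hΦ.ev_polyCre_eq_zero k hp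
  map_add' k l := hΦ.hom_ext_cls fun p => hΦ.evQ_injective (by
    rw [LinearMap.add_apply, descend_cls, descend_cls, descend_cls, map_add, evQ_cls, evQ_cls,
      evQ_cls]
    simp only [polyCre_apply, map_sub, ev_X_add_mul, dirDeriv_add, map_add]
    abel)
  map_smul' c k := hΦ.hom_ext_cls fun p => hΦ.evQ_injective (by
    rw [RingHom.id_apply, LinearMap.smul_apply, descend_cls, descend_cls, map_smul, evQ_cls,
      evQ_cls]
    simp only [polyCre_apply, map_smul, map_sub, ev_X_smul_mul, dirDeriv_smul, smul_sub])

theorem creQ_cls (hΦ : IsGaussianField Φ) (k : L) (p : MvPolynomial L ℝ) :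
    hΦ.creQ k (hΦ.cls p) = hΦ.cls (polyCre k p) :=
  hΦ.descend_cls _ (fun _ hp => hΦ.ev_polyCre_eq_zero k hp) p

theorem annQ_comm (hΦ : IsGaussianField Φ) (h k : L) :
    hΦ.annQ h * hΦ.annQ k = hΦ.annQ k * hΦ.annQ h :=
  hΦ.hom_ext_cls fun p => by
    rw [Module.End.mul_apply, Module.End.mul_apply, annQ_cls, annQ_cls, annQ_cls, annQ_cls,
      dirDeriv_comm]

theorem creQ_comm (hΦ : IsGaussianField Φ) (h k : L) :
    hΦ.creQ h * hΦ.creQ k = hΦ.creQ k * hΦ.creQ h :=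
  hΦ.hom_ext_cls fun p => by
    rw [Module.End.mul_apply, Module.End.mul_apply, creQ_cls, creQ_cls, creQ_cls, creQ_cls,
      polyCre_comm]

theorem annQ_mul_creQ (hΦ : IsGaussianField Φ) (h k : L) :
    hΦ.annQ h * hΦ.creQ k =
      hΦ.creQ k * hΦ.annQ h + algebraMap ℝ (Module.End ℝ hΦ.PolyField) ⟪h, k⟫ :=
  hΦ.hom_ext_cls fun p => by
    rw [LinearMap.add_apply, Module.End.mul_apply, Module.End.mul_apply,
      Module.algebraMap_end_apply, creQ_cls, annQ_cls, annQ_cls, creQ_cls, dirDeriv_polyCre,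
      map_add, map_smul]

/-- The representation of the CCR algebra on the polynomials in the field. -/
def fieldRep (hΦ : IsGaussianField Φ) : CCR L →ₐ[ℝ] Module.End ℝ hΦ.PolyField :=
  CCR.lift (A := Module.End ℝ hΦ.PolyField) hΦ.annQ hΦ.creQ hΦ.annQ_comm hΦ.creQ_comm
    hΦ.annQ_mul_creQ

theorem fieldRep_ann (hΦ : IsGaussianField Φ) (k : L) (p : MvPolynomial L ℝ) :
    hΦ.fieldRep (CCR.ann L k) (hΦ.cls p) = hΦ.cls (dirDeriv k p) := by
  rw [fieldRep, CCR.lift_ann, annQ_cls]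

theorem fieldRep_cre (hΦ : IsGaussianField Φ) (k : L) (p : MvPolynomial L ℝ) :
    hΦ.fieldRep (CCR.cre L k) (hΦ.cls p) = hΦ.cls (polyCre k p) := by
  rw [fieldRep, CCR.lift_cre, creQ_cls]

theorem inner_fieldRep_cre (hΦ : IsGaussianField Φ) (k : L) (x y : hΦ.PolyField) :
    ⟪hΦ.evQ (hΦ.fieldRep (CCR.cre L k) x), hΦ.evQ y⟫ =
      ⟪hΦ.evQ x, hΦ.evQ (hΦ.fieldRep (CCR.ann L k) y)⟫ := by
  obtain ⟨p, rfl⟩ := hΦ.cls_surjective x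
  obtain ⟨q, rfl⟩ := hΦ.cls_surjective y
  rw [fieldRep_ann, fieldRep_cre, evQ_cls, evQ_cls, evQ_cls, evQ_cls, inner_polyCre]

theorem norm_evQ_one (hΦ : IsGaussianField Φ) : ‖hΦ.evQ (hΦ.cls 1)‖ = 1 := by
  have h : ‖hΦ.evQ (hΦ.cls 1)‖ ^ 2 = 1 := by
    rw [← real_inner_self_eq_norm_sq, evQ_cls, inner_ev_ev, mul_one, hΦ.expMoment_one]
    simp
  exact (pow_eq_one_iff_of_nonneg (norm_nonneg _) two_ne_zero).1 h

theorem isFockState_fieldRep (hΦ : IsGaussianField Φ) :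
    CCR.IsFockState (vectorState hΦ.fieldRep hΦ.evQ (hΦ.cls 1)) :=
  isFockState_vectorState _ _ hΦ.inner_fieldRep_cre hΦ.norm_evQ_one fun k => by
    rw [fieldRep_ann, Derivation.map_one_eq_zero, map_zero]

/-- The constant function `1` is cyclic for the polynomials in the field. -/
theorem exists_fieldRep_one_eq (hΦ : IsGaussianField Φ) (p : MvPolynomial L ℝ) :
    ∃ A, hΦ.fieldRep A (hΦ.cls 1) = hΦ.cls p := by
  induction p using MvPolynomial.induction_on with
  | C c =>
    refine ⟨algebraMap ℝ _ c, ?_⟩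
    rw [AlgHom.commutes, Module.algebraMap_end_apply, ← map_smul, MvPolynomial.smul_eq_C_mul,
      mul_one]
  | add p q hp hq =>
    obtain ⟨A, hA⟩ := hp
    obtain ⟨B, hB⟩ := hq
    exact ⟨A + B, by rw [map_add, LinearMap.add_apply, hA, hB, map_add]⟩
  | mul_X p h hp =>
    obtain ⟨A, hA⟩ := hp
    -- `a*(h) + a(h)` acts as `(X_h - ∂_h) + ∂_h`, that is, as multiplication by the field.
    refine ⟨(CCR.cre L h + CCR.ann L h) * A, ?_⟩
    rw [map_mul, Module.End.mul_apply, hA, map_add, LinearMap.add_apply, fieldRep_ann,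
      fieldRep_cre, ← map_add, polyCre_apply, sub_add_cancel, mul_comm]

/-! ### The isometry and its values on exponential vectors -/

/-- The isometry from the Fock space which intertwines the two representations. -/
theorem exists_isometry (hΦ : IsGaussianField Φ) : ∃ V : Fock L →ₗᵢ[ℝ] Lp ℝ 2 P, ∀ A,
    V (FockAlg.toFock (fockRep A (vacuum L))) = hΦ.evQ (hΦ.fieldRep A (hΦ.cls 1)) := by
  let e : CCR L →ₗ[ℝ] Fock L :=
    FockAlg.toFock ∘ₗ (LinearMap.applyₗ (vacuum L)) ∘ₗ fockRep.toLinearMap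
  let f : CCR L →ₗ[ℝ] Lp ℝ 2 P :=
    hΦ.evQ ∘ₗ (LinearMap.applyₗ (hΦ.cls 1)) ∘ₗ hΦ.fieldRep.toLinearMap
  have he : DenseRange e := by
    refine (dense_range_toFock (L := L)).mono ?_
    rintro _ ⟨x, rfl⟩
    obtain ⟨A, rfl⟩ := exists_fockRep_vacuum_eq x
    exact ⟨A, rfl⟩
  -- Both squared norms are the value of a Fock state at `A* A`, and there is only one Fock state.
  -- So `e A ↦ f A` is well defined and isometric on a dense subspace.
  have hn : ∀ A, ‖f A‖ = ‖e A‖ := fun A => by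
    have h : ‖f A‖ ^ 2 = ‖e A‖ ^ 2 := by
      rw [← real_inner_self_eq_norm_sq, ← real_inner_self_eq_norm_sq]
      refine (inner_rep_rep _ _ hΦ.inner_fieldRep_cre A A).trans ?_
      refine Eq.trans ?_ (inner_rep_rep _ _ inner_fockRep_cre A A).symm
      rw [hΦ.isFockState_fieldRep.unique (isFockState_fockState L), fockState_eq]
    exact (pow_left_inj₀ (norm_nonneg _) (norm_nonneg _) two_ne_zero).1 h
  have hb : ∃ C, ∀ A, ‖f A‖ ≤ C * ‖e A‖ := ⟨1, fun A => by rw [one_mul, hn]⟩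
  have hV : ∀ A, f.extendOfNorm e (e A) = f A := LinearMap.extendOfNorm_eq he hb
  refine ⟨⟨(f.extendOfNorm e).toLinearMap, fun x => ?_⟩, hV⟩
  refine he.induction_on (p := fun x => ‖f.extendOfNorm e x‖ = ‖x‖) x
    (isClosed_eq (by fun_prop) (by fun_prop)) fun A => ?_
  rw [hV, hn]

/-- The isometry maps exponential vectors to normalized exponentials. -/
theorem isometry_expVec (hΦ : IsGaussianField Φ) (V : Fock L →ₗᵢ[ℝ] Lp ℝ 2 P)
    (hV : ∀ A, V (FockAlg.toFock (fockRep A (vacuum L))) = hΦ.evQ (hΦ.fieldRep A (hΦ.cls 1)))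
    (k : L) : V (expVec k) = hΦ.expField k := by
  -- The polynomials `p` are never computed: only their pairing with the exponential is needed, and
  -- each creator contributes a factor `‖k‖²`.
  have hpow : ∀ n : ℕ, ∃ p, hΦ.fieldRep (CCR.cre L k ^ n) (hΦ.cls 1) = hΦ.cls p ∧
      ⟪hΦ.ev p, hΦ.expField k⟫ = (‖k‖ ^ 2) ^ n := by
    intro n
    induction n with
    | zero =>
      refine ⟨1, by rw [pow_zero, map_one, Module.End.one_apply], ?_⟩
      rw [inner_ev_expField, hΦ.expMoment_one, ← Real.exp_add, pow_zero, Real.exp_eq_one_iff]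
      ring
    | succ n ih =>
      obtain ⟨p, hp, hi⟩ := ih
      refine ⟨polyCre k p, ?_, ?_⟩
      · rw [pow_succ', map_mul, Module.End.mul_apply, hp, fieldRep_cre]
      · rw [inner_polyCre_expField, hi, real_inner_self_eq_norm_sq, pow_succ' (‖k‖ ^ 2)]
  have hinner : ⟪V (expVec k), hΦ.expField k⟫ = Real.exp (‖k‖ ^ 2) := by
    have h1 := ((hasSum_expVec k).mapL V.toContinuousLinearMap).mapL
      (innerSL ℝ (hΦ.expField k))
    have h2 := NormedSpace.expSeries_div_hasSum_exp (𝔸 := ℝ) (‖k‖ ^ 2)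
    rw [← Real.exp_eq_exp_ℝ] at h2
    rw [real_inner_comm]
    refine HasSum.unique (f := fun n : ℕ => (‖k‖ ^ 2) ^ n / (n.factorial : ℝ)) ?_ h2
    have hf : ∀ n : ℕ, (‖k‖ ^ 2) ^ n / (n.factorial : ℝ) = ⟪hΦ.expField k,
        V (FockAlg.toFock (fockRep ((n.factorial : ℝ)⁻¹ • CCR.cre L k ^ n) (vacuum L)))⟫ :=
      fun n => by
        obtain ⟨p, hp, hi⟩ := hpow n
        rw [hV, map_smul, LinearMap.smul_apply, map_smul, real_inner_smul_right, hp, evQ_cls,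
          real_inner_comm, hi, div_eq_inv_mul]
    rw [funext hf]
    exact h1
  have hnorm : ‖V (expVec k)‖ ^ 2 = Real.exp (‖k‖ ^ 2) := by
    rw [V.norm_map, ← real_inner_self_eq_norm_sq, lp.inner_eq_tsum, Real.exp_eq_exp_ℝ]
    rw [← (NormedSpace.expSeries_div_hasSum_exp (𝔸 := ℝ) (‖k‖ ^ 2)).tsum_eq]
    refine tsum_congr fun n => ?_
    change ⟪(((√(n.factorial : ℝ))⁻¹ • powTensor n k : SymTensor L n) :
      UniformSpace.Completion (SymTensor L n)), (((√(n.factorial : ℝ))⁻¹ • powTensor n k :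
      SymTensor L n) : UniformSpace.Completion (SymTensor L n))⟫ = _
    rw [UniformSpace.Completion.inner_coe, real_inner_self_eq_norm_sq, norm_smul, mul_pow,
      norm_powTensor_sq, norm_inv, inv_pow, Real.norm_eq_abs, sq_abs,
      Real.sq_sqrt (by positivity), div_eq_inv_mul]
  -- Equality in Cauchy–Schwarz: the inner product and both squared norms equal `exp(‖k‖²)`, so the
  -- difference has norm zero.
  rw [← sub_eq_zero, ← norm_eq_zero, ← sq_eq_zero_iff, norm_sub_sq_real, hinner, hnorm,
    hΦ.norm_expField_sq]
  ring

end IsGaussianField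

end GaussianRep

/-! ### Determination of laws by Laplace transforms and linear combinations -/

section Laws

variable {Ω : Type*} [MeasurableSpace Ω] {μ ν : Measure Ω}

/-- Measures with the same law of a process agree on the σ-algebra generated by the process. -/
theorem measure_eq_of_map_process_eq {T : Type*} {Y : T → Ω → ℝ} (hY : ∀ t, Measurable (Y t))
    (h : μ.map (fun ω t => Y t ω) = ν.map (fun ω t => Y t ω)) {B : Set Ω}
    (hB : MeasurableSet[⨆ t, MeasurableSpace.comap (Y t) inferInstance] B) : μ B = ν B := by
  have hm : Measurable fun ω t => Y t ω := measurable_pi_lambda _ hY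
  have : (⨆ t, MeasurableSpace.comap (Y t) inferInstance : MeasurableSpace Ω) =
      MeasurableSpace.comap (fun ω t => Y t ω) MeasurableSpace.pi := by
    rw [MeasurableSpace.pi, MeasurableSpace.comap_iSup]
    simp_rw [MeasurableSpace.comap_comp]
    rfl
  rw [this] at hB
  obtain ⟨S, hS, rfl⟩ := hB
  rw [← Measure.map_apply hm hS, h, Measure.map_apply hm hS]

variable [IsFiniteMeasure μ] [IsFiniteMeasure ν]

/-- Laws with finite exponential moments are determined by their Laplace transform. -/
theorem map_eq_of_mgf_eq {X : Ω → ℝ} (hμ : AEMeasurable X μ) (hν : AEMeasurable X ν)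
    (hint : ∀ t : ℝ, Integrable (fun ω => Real.exp (t * X ω)) μ) (h : mgf X μ = mgf X ν) :
    μ.map X = ν.map X := by
  have h0 : μ = 0 ↔ ν = 0 := by
    have := congrFun h 0
    rw [mgf_zero', mgf_zero'] at this
    rw [← Measure.measure_univ_eq_zero, ← Measure.measure_univ_eq_zero (μ := ν),
      ← measureReal_eq_zero_iff, ← measureReal_eq_zero_iff, this]
  have hset : integrableExpSet X μ = Set.univ := Set.eq_univ_of_forall hint
  -- Analytic continuation from the real line: all exponential moments being finite, the strip of
  -- agreement is all of `ℂ`, including the imaginary axis.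
  have heq := eqOn_complexMGF_of_mgf' h h0
  rw [hset, interior_univ] at heq
  exact Measure.ext_of_complexMGF_eq hμ hν (funext fun z => heq (Set.mem_univ _))

/-- The law of a process is determined by the laws of the finite linear combinations. -/
theorem map_process_eq {T : Type*} {Y : T → Ω → ℝ} (hY : ∀ t, Measurable (Y t))
    (h : ∀ (I : Finset T) (c : I → ℝ),
      μ.map (fun ω => ∑ i, c i * Y i ω) = ν.map (fun ω => ∑ i, c i * Y i ω)) :
    μ.map (fun ω t => Y t ω) = ν.map (fun ω t => Y t ω) := by
  classical
  have hm : Measurable fun ω t => Y t ω := measurable_pi_lambda _ hY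
  -- Projective limits of finite measures are unique, so finite-dimensional laws suffice.
  have hμ := isProjectiveLimit_map (X := Y) (P := μ) hm.aemeasurable
  have hν := isProjectiveLimit_map (X := Y) (P := ν) hm.aemeasurable
  suffices H : (fun I : Finset T => μ.map fun ω => I.restrict fun t => Y t ω) =
      fun I : Finset T => ν.map fun ω => I.restrict fun t => Y t ω by
    rw [H] at hμ
    exact hμ.unique hν
  funext I
  have hI : Measurable fun ω => I.restrict fun t => Y t ω :=
    (Finset.measurable_restrict I).comp hm
  -- Cramér–Wold: the characteristic function at `ℓ` depends only on the law of `ℓ` applied to the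
  -- vector, a linear combination of its coordinates.
  refine Measure.ext_of_charFunDual (funext fun ℓ => ?_)
  have hℓ : (ℓ ∘ fun ω => I.restrict fun t => Y t ω) =
      fun ω => ∑ i : I, ℓ (Pi.single i 1) * Y i ω := by
    funext ω
    conv_lhs => rw [Function.comp_apply,
      ← Finset.univ_sum_single (I.restrict fun t => Y t ω), map_sum]
    refine Finset.sum_congr rfl fun i _ => ?_
    have : (Pi.single i (I.restrict (fun t => Y t ω) i) : I → ℝ) =
        Y i ω • Pi.single i (1 : ℝ) := by
      rw [← Pi.single_smul, smul_eq_mul, mul_one]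
      rfl
    rw [this, map_smul, smul_eq_mul, mul_comm]
  rw [charFunDual_eq_charFun_map_one, charFunDual_eq_charFun_map_one,
    Measure.map_map (by fun_prop) hI, Measure.map_map (by fun_prop) hI, hℓ, h I]

end Laws

/-! ### Totality of the exponentials; existence and uniqueness of the unitary -/

section Density

variable {L : Type*} [NormedAddCommGroup L] [InnerProductSpace ℝ L]
  {Ω : Type*} [MeasurableSpace Ω] {P : Measure Ω} {Φ : L →ₗ[ℝ] Lp ℝ 2 P}

theorem field_sum (Φ : L →ₗ[ℝ] Lp ℝ 2 P) {ι : Type*} (s : Finset ι) (c : ι → ℝ) (h : ι → L) :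
    Φ (∑ i ∈ s, c i • h i) =ᵐ[P] fun ω => ∑ i ∈ s, c i * Φ (h i) ω := by
  classical
  induction s using Finset.induction_on with
  | empty => simp only [Finset.sum_empty, map_zero]; exact Lp.coeFn_zero _ _ _
  | insert i s hi ih =>
    simp only [Finset.sum_insert hi]
    filter_upwards [field_add Φ (c i • h i) (∑ i ∈ s, c i • h i), field_smul Φ (c i) (h i), ih]
      with ω h1 h2 h3
    rw [h1, h2, h3]

theorem integral_withDensity_ofReal {F : Ω → ℝ} (hF : Measurable F) (g : Ω → ℝ) :
    ∫ ω, g ω ∂(P.withDensity fun ω => ENNReal.ofReal (F ω)) = ∫ ω, max (F ω) 0 * g ω ∂P := by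
  rw [integral_withDensity_eq_integral_toReal_smul hF.ennreal_ofReal
    (Filter.Eventually.of_forall fun _ => ENNReal.ofReal_lt_top)]
  simp only [ENNReal.toReal_ofReal', smul_eq_mul]

theorem integrable_withDensity_ofReal {F g : Ω → ℝ} (hF : Measurable F)
    (hg : Integrable (fun ω => max (F ω) 0 * g ω) P) :
    Integrable g (P.withDensity fun ω => ENNReal.ofReal (F ω)) := by
  rw [integrable_withDensity_iff_integrable_smul' hF.ennreal_ofReal
    (Filter.Eventually.of_forall fun _ => ENNReal.ofReal_lt_top)]
  simpa only [ENNReal.toReal_ofReal', smul_eq_mul] using hg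

variable [IsProbabilityMeasure P]

/-- The exponentials of a generating Gaussian field are total in `L²`. -/
theorem IsGaussianField.eq_zero_of_integral_exp (hΦ : IsGaussianField Φ) (hgen : IsGeneratedBy Φ)
    (F : Lp ℝ 2 P) (hF : ∀ k, ∫ ω, F ω * Real.exp (Φ k ω) ∂P = 0) : F = 0 := by
  have hFm : Measurable F := (Lp.stronglyMeasurable F).measurable
  have hFn : Measurable fun ω => -F ω := hFm.neg
  have hF2 : MemLp F 2 P := Lp.memLp F
  have hFn2 : MemLp (fun ω => -F ω) 2 P := hF2.neg
  have hFi : Integrable F P := hF2.integrable one_le_two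
  have hmax : ∀ {G : Ω → ℝ}, MemLp G 2 P → ∀ k : L,
      Integrable (fun ω => max (G ω) 0 * Real.exp (Φ k ω)) P := fun hG k => by
    have h2 : MemLp (fun ω => max (_ : ℝ) 0) 2 P := hG.pos_part
    exact h2.integrable_mul (hΦ.hasAllMoments_exp k 2 ENNReal.ofNat_ne_top)
  -- `μ` and `ν` have densities `F⁺` and `F⁻`, since `ENNReal.ofReal` truncates at `0`. The
  -- hypothesis says that they give every `exp(Φ(k))` the same integral, and the aim is `μ = ν`.
  set μ := P.withDensity fun ω => ENNReal.ofReal (F ω) with hμ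
  set ν := P.withDensity fun ω => ENNReal.ofReal (-F ω) with hν
  have : IsFiniteMeasure μ := isFiniteMeasure_withDensity_ofReal hFi.2
  have : IsFiniteMeasure ν := isFiniteMeasure_withDensity_ofReal hFi.neg.2
  have hμP : μ ≪ P := withDensity_absolutelyContinuous _ _
  have hνP : ν ≪ P := withDensity_absolutelyContinuous _ _
  have hY : ∀ k, Measurable (Φ k) := fun k => (Lp.stronglyMeasurable (Φ k)).measurable
  have hexp : ∀ (k : L) (t : ℝ), (fun ω => Real.exp (t * Φ k ω)) =ᵐ[P]
      fun ω => Real.exp (Φ (t • k) ω) := fun k t => by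
    filter_upwards [field_smul Φ t k] with ω h
    rw [h]
  have hone : ∀ k, μ.map (Φ k) = ν.map (Φ k) := fun k => by
    refine map_eq_of_mgf_eq (hY k).aemeasurable (hY k).aemeasurable (fun t => ?_) ?_
    · exact (integrable_congr (hμP (hexp k t))).2
        (integrable_withDensity_ofReal hFm (hmax hF2 (t • k)))
    · funext t
      rw [mgf, mgf, integral_congr_ae (hμP (hexp k t)), integral_congr_ae (hνP (hexp k t)), hμ, hν,
        integral_withDensity_ofReal hFm, integral_withDensity_ofReal hFn, ← sub_eq_zero,
        ← integral_sub (hmax hF2 _) (hmax hFn2 _)]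
      refine Eq.trans ?_ (hF (t • k))
      refine integral_congr_ae (Filter.Eventually.of_forall fun ω => ?_)
      simp only [← sub_mul]
      congr 1
      rcases le_total 0 (F ω) with h | h
      · rw [max_eq_left h, max_eq_right (neg_nonpos.2 h), sub_zero]
      · rw [max_eq_right h, max_eq_left (neg_nonneg.2 h), zero_sub, neg_neg]
  -- Linearity of the field makes every finite linear combination almost surely a single `Φ(k)`, so
  -- the one-dimensional laws determine the law of the process.
  have hproc := map_process_eq (μ := μ) (ν := ν) hY fun I c => by
    have := field_sum Φ Finset.univ c fun i : I => (i : L)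
    rw [← Measure.map_congr (hμP this), ← Measure.map_congr (hνP this), hone]
  have hμν : μ = ν := Measure.ext fun A hA => by
    -- Null sets of `P` are null for both measures, so `A` may be replaced by an event generated by
    -- the field.
    obtain ⟨B, hB, hAB⟩ := hgen A hA
    rw [measure_congr (hμP hAB), measure_congr (hνP hAB),
      measure_eq_of_map_process_eq hY hproc hB]
  have hae := (withDensity_eq_iff hFm.ennreal_ofReal.aemeasurable
    hFn.ennreal_ofReal.aemeasurable hFi.lintegral_lt_top.ne).1 hμν
  refine Lp.ext ?_
  filter_upwards [hae, Lp.coeFn_zero ℝ 2 P] with ω h1 h2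
  rw [h2, Pi.zero_apply]
  rcases le_total 0 (F ω) with h | h
  · rw [ENNReal.ofReal_of_nonpos (p := -F ω) (neg_nonpos.2 h), ENNReal.ofReal_eq_zero] at h1
    exact le_antisymm h1 h
  · rw [ENNReal.ofReal_of_nonpos h, eq_comm, ENNReal.ofReal_eq_zero] at h1
    exact le_antisymm h (neg_nonpos.1 h1)

theorem IsGaussianField.dense_span_expField (hΦ : IsGaussianField Φ) (hgen : IsGeneratedBy Φ) :
    Dense (Submodule.span ℝ (Set.range hΦ.expField) : Set (Lp ℝ 2 P)) := by
  rw [Submodule.dense_iff_topologicalClosure_eq_top, Submodule.topologicalClosure_eq_top_iff,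
    Submodule.eq_bot_iff]
  intro F hF
  refine hΦ.eq_zero_of_integral_exp hgen F fun k => ?_
  have h := (Submodule.mem_orthogonal _ _).1 hF _ (Submodule.subset_span ⟨k, rfl⟩)
  have h' : Real.exp (-(1 / 2 * ‖k‖ ^ 2)) * ∫ ω, F ω * Real.exp (Φ k ω) ∂P = 0 := by
    rw [← h, L2.inner_def, ← integral_const_mul]
    refine integral_congr_ae ?_
    filter_upwards [hΦ.coeFn_expField k] with ω h2
    rw [h2, sub_eq_add_neg, Real.exp_add, RCLike.inner_apply, conj_trivial]
    ring
  exact (mul_eq_zero.1 h').resolve_left (Real.exp_ne_zero _)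

/-- The isometry of `exists_isometry` is onto. -/
theorem IsGaussianField.exists_unitary (hΦ : IsGaussianField Φ) (hgen : IsGeneratedBy Φ) :
    ∃ W : Fock L ≃ₗᵢ[ℝ] Lp ℝ 2 P, (∀ k, W (expVec k) = hΦ.expField k) ∧
      ∀ A, W (FockAlg.toFock (fockRep A (vacuum L))) = hΦ.evQ (hΦ.fieldRep A (hΦ.cls 1)) := by
  obtain ⟨V, hV⟩ := hΦ.exists_isometry
  have hexp := hΦ.isometry_expVec V hV
  have hsurj : Function.Surjective V := by
    -- An isometry from a complete space has closed range; since it contains the total set of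
    -- exponentials, it is everything.
    have hcl : IsClosed (LinearMap.range V.toLinearMap : Set (Lp ℝ 2 P)) := by
      rw [LinearMap.coe_range]
      exact V.isometry.isClosedEmbedding.isClosed_range
    have hle : Submodule.span ℝ (Set.range hΦ.expField) ≤ LinearMap.range V.toLinearMap :=
      Submodule.span_le.2 (by rintro _ ⟨k, rfl⟩; exact ⟨expVec k, hexp k⟩)
    intro F
    exact closure_minimal hle hcl (hΦ.dense_span_expField hgen F)
  exact ⟨LinearIsometryEquiv.ofSurjective V hsurj, hexp, hV⟩

/-- A unitary is determined by its values on the exponential vectors. -/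
theorem IsGaussianField.unitary_unique (hΦ : IsGaussianField Φ) (hgen : IsGeneratedBy Φ)
    {W W' : Fock L ≃ₗᵢ[ℝ] Lp ℝ 2 P} (hW : ∀ k, W (expVec k) = hΦ.expField k)
    (hW' : ∀ k, W' (expVec k) = hΦ.expField k) : W' = W := by
  -- The inverses are compared because totality has been shown for the exponentials in `L²`, not for
  -- the vectors `e^k` in the Fock space.
  have h : (W'.symm : Lp ℝ 2 P →L[ℝ] Fock L) = (W.symm : Lp ℝ 2 P →L[ℝ] Fock L) := by
    refine ContinuousLinearMap.ext_on (hΦ.dense_span_expField hgen) ?_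
    rintro _ ⟨k, rfl⟩
    change W'.symm (hΦ.expField k) = W.symm (hΦ.expField k)
    rw [← hW k, W.symm_apply_apply, hW k, ← hW' k, W'.symm_apply_apply]
  have hs : ∀ F, W'.symm F = W.symm F := fun F => DFunLike.congr_fun h F
  ext1 x
  rw [← W.symm.injective.eq_iff, W.symm_apply_apply, ← hs, W'.symm_apply_apply]

end Density

/-! ### The Malliavin derivative on polynomial fields -/

section Malliavin

variable {L : Type*} [NormedAddCommGroup L] [InnerProductSpace ℝ L]
  {Ω : Type*} [MeasurableSpace Ω] {P : Measure Ω} {Φ : L →ₗ[ℝ] Lp ℝ 2 P}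

theorem polyFun_eq_fieldEval (Φ : L →ₗ[ℝ] Lp ℝ 2 P) {n : ℕ} (h : Fin n → L)
    (p : MvPolynomial (Fin n) ℝ) : polyFun Φ h p = fieldEval Φ (MvPolynomial.rename h p) := by
  funext ω
  rw [polyFun, fieldEval, MvPolynomial.eval_rename]
  rfl

/-- The chain rule. It identifies the pairing of the gradient with `k` as the derivation `∂_k`, and
holds even when the `h j` are not distinct. -/
theorem dirDeriv_rename (k : L) {n : ℕ} (h : Fin n → L) (p : MvPolynomial (Fin n) ℝ) :
    dirDeriv k (MvPolynomial.rename h p) =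
      ∑ j, ⟪k, h j⟫ • MvPolynomial.rename h (MvPolynomial.pderiv j p) := by
  induction p using MvPolynomial.induction_on with
  | C c =>
    rw [MvPolynomial.rename_C, ← MvPolynomial.algebraMap_eq, Derivation.map_algebraMap]
    simp
  | add p q hp hq => simp only [map_add, hp, hq, smul_add, Finset.sum_add_distrib]
  | mul_X p i hp =>
    simp only [map_mul, MvPolynomial.rename_X, Derivation.leibniz, dirDeriv_X, hp,
      MvPolynomial.pderiv_X, smul_eq_mul, map_add, smul_add, Finset.sum_add_distrib]
    congr 1
    · rw [Finset.sum_eq_single i]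
      · rw [Pi.single_eq_same, map_one, mul_one, MvPolynomial.smul_eq_C_mul, mul_comm]
      · intro j _ hj
        rw [Pi.single_eq_of_ne' hj, map_zero, mul_zero, smul_zero]
      · simp
    · rw [Finset.mul_sum]
      exact Finset.sum_congr rfl fun j _ => mul_smul_comm _ _ _

namespace IsGaussianField

variable [IsProbabilityMeasure P]

theorem polyDomain_eq (hΦ : IsGaussianField Φ) : polyDomain Φ = LinearMap.range hΦ.ev := by
  refine le_antisymm (Submodule.span_le.2 ?_) ?_
  · rintro F ⟨n, h, p, hF⟩
    refine ⟨MvPolynomial.rename h p, Lp.ext ?_⟩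
    rw [polyFun_eq_fieldEval] at hF
    exact (hΦ.coeFn_ev _).trans hF.symm
  · rintro _ ⟨p, rfl⟩
    obtain ⟨n, h, _, q, rfl⟩ := MvPolynomial.exists_fin_rename p
    refine Submodule.subset_span ⟨n, h, q, ?_⟩
    rw [polyFun_eq_fieldEval]
    exact hΦ.coeFn_ev _

theorem memLp_gradient (hΦ : IsGaussianField Φ) {n : ℕ} (h : Fin n → L)
    (p : MvPolynomial (Fin n) ℝ) :
    MemLp (fun ω => ∑ j, polyFun Φ h (MvPolynomial.pderiv j p) ω • h j) 2 P := by
  refine memLp_finsetSum _ fun j _ => ?_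
  rw [polyFun_eq_fieldEval]
  exact ((ContinuousLinearMap.id ℝ ℝ).smulRight (h j)).comp_memLp'
    (hΦ.hasAllMoments_fieldEval _ 2 ENNReal.ofNat_ne_top)

/-- One polynomial `p` serves all directions `k`. The property is linear, so it passes from the
generating pairs to their span, reducing questions about the vector-valued derivative to the scalar
`∂_k`. -/
theorem exists_of_mem_malliavinGraph (hΦ : IsGaussianField Φ) {x : Lp ℝ 2 P × Lp L 2 P}
    (hx : x ∈ malliavinGraph Φ) :
    ∃ p, x.1 = hΦ.ev p ∧ ∀ k, (innerSL ℝ k).compLpL 2 P x.2 = hΦ.ev (dirDeriv k p) := by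
  induction hx using Submodule.span_induction with
  | mem x hx =>
    obtain ⟨n, h, p, h1, h2⟩ := hx
    refine ⟨MvPolynomial.rename h p, Lp.ext ?_, fun k => Lp.ext ?_⟩
    · rw [polyFun_eq_fieldEval] at h1
      exact h1.trans (hΦ.coeFn_ev _).symm
    · filter_upwards [h2, (innerSL ℝ k).coeFn_compLpL x.2, hΦ.coeFn_ev
        (dirDeriv k (MvPolynomial.rename h p))] with ω h3 h4 h5
      rw [h4, h5, h3, dirDeriv_rename, map_sum, fieldEval, map_sum]
      refine Finset.sum_congr rfl fun j _ => ?_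
      rw [polyFun_eq_fieldEval, map_smul, MvPolynomial.smul_eval, innerSL_apply_apply, smul_eq_mul,
        mul_comm]
      rfl
  | zero => exact ⟨0, by simp, fun k => by simp⟩
  | add x y _ _ hx hy =>
    obtain ⟨p, hp, hp'⟩ := hx
    obtain ⟨q, hq, hq'⟩ := hy
    exact ⟨p + q, by rw [Prod.fst_add, hp, hq, map_add], fun k => by
      rw [Prod.snd_add, map_add, hp', hq', map_add, map_add]⟩
  | smul c x _ hx =>
    obtain ⟨p, hp, hp'⟩ := hx
    exact ⟨c • p, by rw [Prod.smul_fst, hp, map_smul], fun k => by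
      rw [Prod.smul_snd, map_smul, hp', Derivation.map_smul, map_smul]⟩

theorem ev_dirDeriv_congr (hΦ : IsGaussianField Φ) (k : L) {p q : MvPolynomial L ℝ}
    (h : hΦ.ev p = hΦ.ev q) : hΦ.ev (dirDeriv k p) = hΦ.ev (dirDeriv k q) := by
  rw [← sub_eq_zero, ← map_sub, ← map_sub]
  exact hΦ.ev_dirDeriv_eq_zero k (by rw [map_sub, h, sub_self])

theorem ev_mem_mulOp_domain (hΦ : IsGaussianField Φ) (k : L) (p : MvPolynomial L ℝ) :
    hΦ.ev p ∈ (mulOp (Φ k)).domain :=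
  (Lp.memLp _).ae_eq (hΦ.ev_X_mul k p)

theorem mulOp_ev (hΦ : IsGaussianField Φ) (k : L) (p : MvPolynomial L ℝ)
    (hp : hΦ.ev p ∈ (mulOp (Φ k)).domain) :
    mulOp (Φ k) ⟨hΦ.ev p, hp⟩ = hΦ.ev (MvPolynomial.X k * p) :=
  Lp.ext ((MemLp.coeFn_toLp hp).trans (hΦ.ev_X_mul k p).symm)

/-- The domain is the projection of the graph, whether or not the graph is single-valued. No
polynomial field is lost, because its gradient is in `L²`. -/
theorem malliavin_domain (hΦ : IsGaussianField Φ) : (malliavin Φ).domain = polyDomain Φ := by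
  rw [malliavin, Submodule.toLinearPMap_domain, malliavinGraph, Submodule.map_span, polyDomain]
  congr 1
  ext F
  constructor
  · rintro ⟨x, ⟨n, h, p, h1, _⟩, rfl⟩
    exact ⟨n, h, p, h1⟩
  · rintro ⟨n, h, p, hF⟩
    exact ⟨(F, (hΦ.memLp_gradient h p).toLp), ⟨n, h, p, hF,
      MemLp.coeFn_toLp (hΦ.memLp_gradient h p)⟩, rfl⟩

theorem malliavinDir_domain (hΦ : IsGaussianField Φ) (k : L) :
    (malliavinDir Φ k).domain = LinearMap.range hΦ.ev :=
  hΦ.malliavin_domain.trans hΦ.polyDomain_eq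

variable [CompleteSpace L]

/-- The Malliavin derivative is well defined. -/
theorem malliavinGraph_functional (hΦ : IsGaussianField Φ) (x : Lp ℝ 2 P × Lp L 2 P)
    (hx : x ∈ malliavinGraph Φ) (h0 : x.1 = 0) : x.2 = 0 := by
  obtain ⟨p, hp, hp'⟩ := hΦ.exists_of_mem_malliavinGraph hx
  refine Lp.ext (Filter.EventuallyEq.trans ?_ (Lp.coeFn_zero _ _ _).symm)
  -- Each functional gives its own null set; separability of the range of a strongly measurable
  -- representative reduces to countably many. By Riesz, which uses completeness of `L`, each
  -- functional is `⟪k, ·⟫` for some `k`.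
  refine ae_eq_zero_of_forall_dual_of_isSeparable ℝ
    (Lp.stronglyMeasurable x.2).isSeparable_range (fun c => ?_)
    (Filter.Eventually.of_forall fun ω => Set.mem_range_self ω)
  have hk : (innerSL ℝ ((InnerProductSpace.toDual ℝ L).symm c)).compLpL 2 P x.2 = 0 := by
    rw [hp']
    exact hΦ.ev_dirDeriv_eq_zero _ (hp ▸ h0)
  filter_upwards [(innerSL ℝ ((InnerProductSpace.toDual ℝ L).symm c)).coeFn_compLpL x.2,
    Lp.coeFn_zero ℝ 2 P] with ω h1 h2
  rw [hk, h2, innerSL_apply_apply, InnerProductSpace.toDual_symm_apply] at h1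
  exact h1.symm

theorem mem_malliavinGraph (hΦ : IsGaussianField Φ) (F : (malliavin Φ).domain) :
    ((F : Lp ℝ 2 P), malliavin Φ F) ∈ malliavinGraph Φ :=
  Submodule.mem_graph_toLinearPMap hΦ.malliavinGraph_functional F

theorem exists_malliavin_eq (hΦ : IsGaussianField Φ) {n : ℕ} (h : Fin n → L)
    (p : MvPolynomial (Fin n) ℝ) : ∃ F : (malliavin Φ).domain, (F : Lp ℝ 2 P) =ᵐ[P] polyFun Φ h p ∧
      malliavin Φ F =ᵐ[P] fun ω => ∑ j, polyFun Φ h (MvPolynomial.pderiv j p) ω • h j := by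
  have hev : hΦ.ev (MvPolynomial.rename h p) =ᵐ[P] polyFun Φ h p := by
    rw [polyFun_eq_fieldEval]
    exact hΦ.coeFn_ev _
  have hmem : hΦ.ev (MvPolynomial.rename h p) ∈ (malliavin Φ).domain := by
    rw [hΦ.malliavin_domain]
    exact Submodule.subset_span ⟨n, h, p, hev⟩
  refine ⟨⟨_, hmem⟩, hev, ?_⟩
  have hG : (hΦ.ev (MvPolynomial.rename h p), (hΦ.memLp_gradient h p).toLp) ∈ malliavinGraph Φ :=
    Submodule.subset_span ⟨n, h, p, hev, MemLp.coeFn_toLp (hΦ.memLp_gradient h p)⟩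
  -- Two points of the graph over the same `F`: their difference lies over `0`, so it vanishes.
  have := hΦ.malliavinGraph_functional _
    (Submodule.sub_mem _ (hΦ.mem_malliavinGraph ⟨_, hmem⟩) hG) (sub_self _)
  have heq : malliavin Φ ⟨_, hmem⟩ = (hΦ.memLp_gradient h p).toLp := sub_eq_zero.1 this
  rw [heq]
  exact MemLp.coeFn_toLp (hΦ.memLp_gradient h p)

theorem malliavinDir_ev (hΦ : IsGaussianField Φ) (k : L) (p : MvPolynomial L ℝ)
    (hp : hΦ.ev p ∈ (malliavinDir Φ k).domain) :
    malliavinDir Φ k ⟨hΦ.ev p, hp⟩ = hΦ.ev (dirDeriv k p) := by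
  -- The polynomial `q` need not be `p`, but both represent the same field, so their derivatives
  -- agree in `L²`.
  obtain ⟨q, hq, hq'⟩ := hΦ.exists_of_mem_malliavinGraph (hΦ.mem_malliavinGraph ⟨_, hp⟩)
  exact (hq' k).trans (hΦ.ev_dirDeriv_congr k hq.symm)

end IsGaussianField

end Malliavin

/-! ### Equality of the unbounded operators, including domains -/

section Intertwining

variable {L : Type*} [NormedAddCommGroup L] [InnerProductSpace ℝ L]
  {Ω : Type*} [MeasurableSpace Ω] {P : Measure Ω} {Φ : L →ₗ[ℝ] Lp ℝ 2 P}

theorem fockOp_toFock (A : CCR L) (x : FockAlg L)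
    (hx : FockAlg.toFock x ∈ (fockOp A).domain) :
    fockOp A ⟨FockAlg.toFock x, hx⟩ = FockAlg.toFock (fockRep A x) := by
  change FockAlg.toFock (fockRep A ((LinearEquiv.ofInjective FockAlg.toFock
    FockAlg.toFock_injective).symm ⟨FockAlg.toFock x, hx⟩)) = _
  congr 2
  exact (LinearEquiv.symm_apply_eq _).2 rfl

namespace IsGaussianField

variable [IsProbabilityMeasure P] (hΦ : IsGaussianField Φ) {W : Fock L ≃ₗᵢ[ℝ] Lp ℝ 2 P}
  (hW : ∀ A, W (FockAlg.toFock (fockRep A (vacuum L))) = hΦ.evQ (hΦ.fieldRep A (hΦ.cls 1)))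

include hW

/-- Cyclicity spreads the intertwining relation from the vacuum: write the field as `B` applied to
`1`, take `x` as `B` applied to the vacuum, and use the relation for `A * B`. -/
theorem exists_fock_preimage (p : MvPolynomial L ℝ) : ∃ x, W (FockAlg.toFock x) = hΦ.ev p ∧
    ∀ A, W (FockAlg.toFock (fockRep A x)) = hΦ.evQ (hΦ.fieldRep A (hΦ.cls p)) := by
  obtain ⟨B, hB⟩ := hΦ.exists_fieldRep_one_eq p
  refine ⟨fockRep B (vacuum L), by rw [hW, hB, evQ_cls], fun A => ?_⟩
  rw [← Module.End.mul_apply, ← map_mul, hW, map_mul, Module.End.mul_apply, hB]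

theorem map_toFock_mem_range_ev (x : FockAlg L) :
    W (FockAlg.toFock x) ∈ LinearMap.range hΦ.ev := by
  obtain ⟨A, rfl⟩ := exists_fockRep_vacuum_eq x
  obtain ⟨p, hp⟩ := hΦ.cls_surjective (hΦ.fieldRep A (hΦ.cls 1))
  exact ⟨p, by rw [hW, ← hp, evQ_cls]⟩

/-- This is `W 𝒟_F = 𝒟`: cyclicity of the vacuum gives one inclusion and cyclicity of `1` the other.
-/
theorem conjOp_fockOp_domain (A : CCR L) :
    (conjOp W (fockOp A)).domain = LinearMap.range hΦ.ev := by
  ext F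
  constructor
  · rintro ⟨x, hx⟩
    have hF : F = W (FockAlg.toFock x) := by
      rw [hx]; exact (W.apply_symm_apply F).symm
    rw [hF]
    exact hΦ.map_toFock_mem_range_ev hW x
  · rintro ⟨p, rfl⟩
    obtain ⟨x, hx, -⟩ := hΦ.exists_fock_preimage hW p
    exact ⟨x, by rw [← hx]; exact (W.symm_apply_apply _).symm⟩

theorem conjOp_fockOp_ev (A : CCR L) (p : MvPolynomial L ℝ)
    (hp : hΦ.ev p ∈ (conjOp W (fockOp A)).domain) :
    conjOp W (fockOp A) ⟨hΦ.ev p, hp⟩ = hΦ.evQ (hΦ.fieldRep A (hΦ.cls p)) := by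
  obtain ⟨x, hx, hA⟩ := hΦ.exists_fock_preimage hW p
  rw [← hA]
  have hs : W.symm (hΦ.ev p) = FockAlg.toFock x := by rw [← hx, W.symm_apply_apply]
  have hm : FockAlg.toFock x ∈ (fockOp A).domain := ⟨x, rfl⟩
  change W (fockOp A ⟨W.symm (hΦ.ev p), hp⟩) = _
  rw [← fockOp_toFock A x hm]
  congr 2
  exact Subtype.ext hs

theorem dense_polyDomain : Dense (polyDomain Φ : Set (Lp ℝ 2 P)) := by
  rw [hΦ.polyDomain_eq]
  refine (W.surjective.denseRange.dense_image W.continuous (dense_range_toFock (L := L))).mono ?_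
  rintro _ ⟨_, ⟨x, rfl⟩, rfl⟩
  exact hΦ.map_toFock_mem_range_ev hW x

variable [CompleteSpace L]

theorem malliavinDir_eq_conjOp (k : L) :
    malliavinDir Φ k = conjOp W (fockOp (CCR.ann L k)) := by
  refine LinearPMap.ext ((hΦ.malliavinDir_domain k).trans
    (hΦ.conjOp_fockOp_domain hW _).symm) fun F hF hF' => ?_
  obtain ⟨p, rfl⟩ : F ∈ LinearMap.range hΦ.ev := hΦ.malliavinDir_domain k ▸ hF
  rw [hΦ.malliavinDir_ev, hΦ.conjOp_fockOp_ev hW, fieldRep_ann, evQ_cls]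

theorem mulOp_sub_malliavinDir_eq_conjOp (k : L) :
    mulOp (Φ k) - malliavinDir Φ k = conjOp W (fockOp (CCR.cre L k)) := by
  have hdom : (mulOp (Φ k) - malliavinDir Φ k).domain = LinearMap.range hΦ.ev := by
    rw [LinearPMap.sub_domain, hΦ.malliavinDir_domain]
    -- The difference lives on the intersection of the two domains; since `Φ(k)` times a polynomial
    -- field is in `L²`, this is all of `𝒟`.
    refine inf_eq_right.2 ?_
    rintro _ ⟨p, rfl⟩
    exact hΦ.ev_mem_mulOp_domain k p
  refine LinearPMap.ext (hdom.trans (hΦ.conjOp_fockOp_domain hW _).symm) fun F hF hF' => ?_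
  obtain ⟨p, rfl⟩ : F ∈ LinearMap.range hΦ.ev := hdom ▸ hF
  rw [LinearPMap.sub_apply, hΦ.mulOp_ev, hΦ.malliavinDir_ev, hΦ.conjOp_fockOp_ev hW, fieldRep_cre,
    evQ_cls, polyCre_apply, map_sub]

end IsGaussianField

end Intertwining

end BoseFock

end

theorem mainTheorem4 {L : Type*} [NormedAddCommGroup L] [InnerProductSpace ℝ L] [CompleteSpace L]
    {Ω : Type*} [MeasurableSpace Ω] (P : Measure Ω) [IsProbabilityMeasure P]
    (Φ : L →ₗ[ℝ] Lp ℝ 2 P) (hΦ : IsGaussianField Φ) (hgen : IsGeneratedBy Φ) :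
    -- the vacuum state is the unique Fock state, and `π_F` is its (GNS) representation
    ((∀ ω : CCR L →ₗ[ℝ] ℝ, CCR.IsFockState ω ↔ ω = fockState L) ∧
      (∀ x : FockAlg L, ∃ A : CCR L, fockRep A (vacuum L) = x) ∧
      Dense (LinearMap.range (FockAlg.toFock (L := L)) : Set (Fock L)) ∧
      (∀ (A : CCR L) (x y : FockAlg L),
        ⟪FockAlg.toFock (fockRep A x), FockAlg.toFock y⟫ =
          ⟪FockAlg.toFock x, FockAlg.toFock (fockRep (star A) y)⟫)) ∧
    -- the Malliavin derivative is well defined, with dense domain the polynomial fields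
    (Dense (polyDomain Φ : Set (Lp ℝ 2 P)) ∧
      (malliavin Φ).domain = polyDomain Φ ∧
      (∀ (n : ℕ) (h : Fin n → L) (p : MvPolynomial (Fin n) ℝ),
        ∃ F : (malliavin Φ).domain,
          (F : Lp ℝ 2 P) =ᵐ[P] polyFun Φ h p ∧
          malliavin Φ F =ᵐ[P] fun ω => ∑ j, polyFun Φ h (MvPolynomial.pderiv j p) ω • h j)) ∧
    -- the unitary `W` and the two realizations
    ∃ W : Fock L ≃ₗᵢ[ℝ] Lp ℝ 2 P,
      (∀ k : L, W (expVec k) =ᵐ[P] fun ω => Real.exp (Φ k ω - 1 / 2 * ‖k‖ ^ 2)) ∧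
      (∀ W' : Fock L ≃ₗᵢ[ℝ] Lp ℝ 2 P,
        (∀ k : L, W' (expVec k) =ᵐ[P] fun ω => Real.exp (Φ k ω - 1 / 2 * ‖k‖ ^ 2)) → W' = W) ∧
      (∀ k : L,
        malliavinDir Φ k = conjOp W (fockOp (CCR.ann L k)) ∧
        mulOp (Φ k) - malliavinDir Φ k = conjOp W (fockOp (CCR.cre L k))) := by
  obtain ⟨W, hexp, hW⟩ := hΦ.exists_unitary hgen
  refine ⟨⟨isFockState_iff, exists_fockRep_vacuum_eq, dense_range_toFock,
    inner_rep_star fockRep FockAlg.toFock inner_fockRep_cre⟩,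
    ⟨hΦ.dense_polyDomain hW, hΦ.malliavin_domain, fun n h p => hΦ.exists_malliavin_eq h p⟩,
    W, fun k => ?_, fun W' hW' => ?_, fun k =>
      ⟨hΦ.malliavinDir_eq_conjOp hW k, hΦ.mulOp_sub_malliavinDir_eq_conjOp hW k⟩⟩
  · rw [hexp]
    exact hΦ.coeFn_expField k
  · exact hΦ.unitary_unique hgen hexp fun k => Lp.ext ((hW' k).trans (hΦ.coeFn_expField k).symm)
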